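/- Let $\rho,a,\lambda>0$, $b\in(0,1)$, $\alpha\in(1,2)$. On the state space $X=(0,\infty)$ consider the discounted AIMD impulsive control problem. A policy $\pi$ consists of impulse moments $0\le T_1<T_2<\dots$ (values in $[0,\infty]$, strictly increasing as long as finite, $T_i\to\infty$; $T_i=\infty$ means that the $i$-th impulse never takes place; $T_0:=0$) and impulses $v_i\in\{1,2,\dots\}$. From the initial state $x(0^-)=x_0>0$ the controlled process $x^\pi(t)$ satisfies $\frac{dx}{dt}=a$ between impulses and $x(T_i)=b^{v_i}x(T_i^-)$ at the finite impulse moments, and it is right-continuous. With the reward rate $c(x)=\frac{x^{1-\alpha}}{1-\alpha}-\lambda x$ put $$J_\rho(x_0,\pi)=\liminf_{T\to\infty}\int_0^T e^{-\rho t}c(x^\pi(t))\,dt\in[-\infty,\infty].$$ (a) The equation $H(x)=0$, where $$H(x)=\Bigl(e^{\frac{\rho x(1-b)}{a}}-1\Bigr)\frac{(1-b)\lambda a}{\rho}-(1-b)e^{\frac{\rho x}{a}}\int_{bx}^x e^{-\frac{\rho u}{a}}u^{-\alpha}\,du-\Bigl(e^{\frac{\rho x(1-b)}{a}}-b\Bigr)\Bigl[\frac{x^{1-\alpha}(1-b^{1-\alpha})}{\alpha-1}+\lambda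 x(1-b)\Bigr],$$ has exactly one positive solution $\bar x$. (b) Let $$w_1=\frac{e^{\rho/a}}{\rho}\int_1^{\bar x}e^{-\frac{\rho u}{a}}u^{-\alpha}\,du-\frac{\lambda(\rho+a)}{\rho^2}-\frac{1}{\rho(\alpha-1)}-\frac{\frac{\bar x^{1-\alpha}(1-b^{1-\alpha})}{\rho(\alpha-1)}+\frac{(1-b)\lambda\bar x}{\rho}+\frac{e^{\rho b\bar x/a}}{\rho}\int_{b\bar x}^{\bar x}e^{-\frac{\rho u}{a}}u^{-\alpha}\,du}{e^{\frac{\rho b\bar x-\rho}{a}}-e^{\frac{\rho\bar x-\rho}{a}}}.$$ For $0<x<\bar x$ put $$W(x)=e^{\frac{\rho}{a}(x-1)}\Bigl(\frac{\lambda}{\rho}+\frac{\lambda a}{\rho^2}+\frac{1}{\rho(\alpha-1)}+w_1\Bigr)-\frac{x^{1-\alpha}}{\rho(\alpha-1)}-\frac{\lambda}{\rho}x-\frac{a\lambda}{\rho^2}-\frac{e^{\frac{\rho}{a}x}}{\rho}\int_1^x e^{-\frac{\rho}{a}u}u^{-\alpha}\,du,$$ and define $W$ recursively by $W(x):=W(bx)$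 on the intervals $[\bar x,\bar x/b)$, $[\bar x/b,\bar x/b^2)$, $\dots$. Then: (i) $W$ is continuous and differentiable everywhere on $(0,\infty)$, and for every policy $\pi$ and every initial state the function $t\mapsto W(x^\pi(t))$ is absolutely continuous on every interval $[T_{i-1},T_i)$, $i\ge1$; (ii) for all $x>0$ the Bellman equation holds: $$\max\Bigl\{\frac{x^{1-\alpha}}{1-\alpha}-\lambda x-\rho W(x)+a\frac{dW}{dx}(x),\ \sup_{i\ge1}\bigl[W(b^ix)-W(x)\bigr]\Bigr\}=0;$$ (iii) with $\mathcal L^*=[\bar x,\infty)$ and $v^*(x)=i$ for $x\in[\bar x/b^{i-1},\bar x/b^i)$, $i\ge 1$, one has $c(x)-\rho W(x)+a\frac{dW}{dx}(x)=0$ for $x\in(0,\infty)\setminus\mathcal L^*$, and $W(b^{v^*(x)}x)-W(x)=0$ and $b^{v^*(x)}x\in(0,\infty)\setminus\mathcal L^*$ for $x\in\mathcal L^*$. (c) For every $x_0>0$, $W(x_0)=\sup_\pi J_\rho(x_0,\pi)=J_\rho(x_0,\pi^*)$, where $\pi^*$ is the feedback policy given by $(\mathcal L^*,v^*)$: starting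 from the current state (the initial state, or the state right after the last impulse), the next impulse is applied as soon as the freely growing state is in $\mathcal L^*$, and the impulse is $v^*$ of the state just before it. This policy exists (its impulse moments tend to infinity), so it is optimal. -/

import Mathlib

open Set Filter Topology MeasureTheory

noncomputable section

namespace AIMD

/-! ### The controlled process

The state space is `X = (0, ∞)`.  Between impulses the state obeys `dx/dt = a`; the impulse
`v ∈ V = {1, 2, …}` (a batch of `v` simultaneous multiplicative decreases) maps `x` to `b ^ v * x`.
Impulses carry no reward of their own. -/

/-- A policy: impulse moments `0 ≤ T 1 < T 2 < …` tending to infinity, with impulses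
`v 1, v 2, …`.  The value `⊤` stands for "never", so that policies with finitely many impulses are
included.  `T 0 = 0` is a convention and `v 0` plays no role. -/
structure Policy where
  T : ℕ → EReal
  v : ℕ → ℕ+
  T_zero : T 0 = 0
  T_one : T 0 ≤ T 1
  T_lt : ∀ i, 1 ≤ i → T i ≠ ⊤ → T i < T (i + 1)
  T_top : ∀ i, T i = ⊤ → T (i + 1) = ⊤
  T_tendsto : Tendsto T atTop (𝓝 ⊤)

/-- `x` is the process controlled by `π` with initial state `x₀`.  The value `x t` is the state
after a possible impulse at time `t`, and `x` is extended by `x₀` to negative times, so that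
`x(0-) = x₀`. -/
structure IsProcess (a b x₀ : ℝ) (π : Policy) (x : ℝ → ℝ) : Prop where
  before : ∀ t, t < 0 → x t = x₀
  start : π.T 1 ≠ 0 → x 0 = x₀
  flow : ∀ t : ℝ, 0 < t → (∀ i, 1 ≤ i → π.T i ≠ (t : EReal)) → HasDerivAt x a t
  right_cont : ∀ t, 0 ≤ t → ContinuousWithinAt x (Ici t) t
  jump : ∀ (i : ℕ) (t : ℝ), 1 ≤ i → π.T i = (t : EReal) →
    x t = b ^ (π.v i : ℕ) * Function.leftLim x t

/-- The state right after the `i`-th impulse (the initial state for `i = 0`). -/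
def postState (x₀ : ℝ) (π : Policy) (x : ℝ → ℝ) (i : ℕ) : ℝ :=
  if i = 0 then x₀ else x (π.T i).toReal

/-- `π`, with its process `x`, is generated by the feedback rule `(L, vf)`: the next impulse takes
place when the state, left to itself after the previous impulse, meets `L` (never, if it does not
meet `L`; recall `sInf ∅ = ⊤`), and the impulse is `vf` of the state just before it. -/
structure FollowsFeedback (a x₀ : ℝ) (L : Set ℝ) (vf : ℝ → ℕ+) (π : Policy) (x : ℝ → ℝ) :
    Prop where
  time : ∀ i : ℕ, π.T (i + 1) = sInf ((fun t : ℝ => (t : EReal)) ''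
    {t : ℝ | π.T i < (t : EReal) ∧ postState x₀ π x i + a * (t - (π.T i).toReal) ∈ L})
  action : ∀ (i : ℕ) (t : ℝ), 1 ≤ i → π.T i = (t : EReal) → π.v i = vf (Function.leftLim x t)

/-! ### The discounted problem -/

/-- The reward rate `c(x) = x ^ (1 - α) / (1 - α) - lam * x`. -/
def rewardRate (α lam x : ℝ) : ℝ := x ^ (1 - α) / (1 - α) - lam * x

/-- The discounted reward `liminf_{T → ∞} ∫_0^T exp (-ρ t) c(x(t)) dt`, in `[-∞, ∞]`. -/
def discountedReward (ρ α lam : ℝ) (x : ℝ → ℝ) : EReal :=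
  liminf (fun T : ℝ =>
    ((∫ t in (0 : ℝ)..T, Real.exp (-ρ * t) * rewardRate α lam (x t) : ℝ) : EReal)) atTop

/-- The value function: the supremum of the discounted reward over all policies. -/
def valueFunction (ρ a b α lam x₀ : ℝ) : EReal :=
  sSup {J : EReal | ∃ (π : Policy) (x : ℝ → ℝ),
    IsProcess a b x₀ π x ∧ J = discountedReward ρ α lam x}

/-- Absolute continuity of a real function on a set (here, on a half-open interval). -/
def AbsContOn (g : ℝ → ℝ) (s : Set ℝ) : Prop :=
  ∀ ε : ℝ, 0 < ε → ∃ δ : ℝ, 0 < δ ∧ ∀ (n : ℕ) (p q : Fin n → ℝ),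
    (∀ k, p k ≤ q k ∧ Icc (p k) (q k) ⊆ s) →
    Pairwise (fun k l => Disjoint (Ioo (p k) (q k)) (Ioo (p l) (q l))) →
    ∑ k, (q k - p k) < δ → ∑ k, |g (q k) - g (p k)| < ε

/-- The verification conditions for a function `W` on `(0, ∞)`, an exceptional set `D` and a
feedback rule `(L, vf)`: (i) regularity, (ii) the discounted Bellman equation, (iii) the feedback
rule realizes the maximum in it. -/
structure VerificationConditions (ρ a b α lam : ℝ) (W : ℝ → ℝ) (D L : Set ℝ) (vf : ℝ → ℕ+) :
    Prop where
  continuousOn : ContinuousOn W (Ioi 0)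
  exceptional_subset : D ⊆ Ioi 0
  differentiableAt : ∀ x, 0 < x → x ∉ D → DifferentiableAt ℝ W x
  absCont : ∀ (x₀ : ℝ) (π : Policy) (x : ℝ → ℝ), 0 < x₀ → IsProcess a b x₀ π x →
    ∀ i : ℕ, AbsContOn (fun t => W (x t)) {t : ℝ | π.T i ≤ (t : EReal) ∧ (t : EReal) < π.T (i + 1)}
  null : ∀ (x₀ : ℝ) (π : Policy) (x : ℝ → ℝ), 0 < x₀ → IsProcess a b x₀ π x →
    volume {t : ℝ | 0 ≤ t ∧ x t ∈ D} = 0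
  bellman : ∀ x, 0 < x → x ∉ D →
    max ((rewardRate α lam x - ρ * W x + a * deriv W x : ℝ) : EReal)
      (⨆ i : ℕ+, ((W (b ^ (i : ℕ) * x) - W x : ℝ) : EReal)) = 0
  bellman_exceptional : ∀ x ∈ D, (⨆ i : ℕ+, ((W (b ^ (i : ℕ) * x) - W x : ℝ) : EReal)) ≤ 0
  measurableSet : MeasurableSet L
  subset : L ⊆ Ioi 0
  flow_eq : ∀ x, 0 < x → x ∉ D → x ∉ L → rewardRate α lam x - ρ * W x + a * deriv W x = 0
  impulse_eq : ∀ x ∈ L, W (b ^ (vf x : ℕ) * x) - W x = 0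
  leaves : ∀ x ∈ L, 0 < b ^ (vf x : ℕ) * x ∧ b ^ (vf x : ℕ) * x ∉ L

/-! ### The explicit solution -/

/-- The integral `∫_p^q exp (-ρ u / a) u ^ (-α) du`. -/
def expInt (ρ a α p q : ℝ) : ℝ := ∫ u in p..q, Real.exp (-(ρ * u / a)) * u ^ (-α)

/-- The function `H`, whose positive zero is the threshold. -/
def H (ρ a b α lam x : ℝ) : ℝ :=
  (Real.exp (ρ * x * (1 - b) / a) - 1) * ((1 - b) * lam * a / ρ)
    - (1 - b) * Real.exp (ρ * x / a) * expInt ρ a α (b * x) x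
    - (Real.exp (ρ * x * (1 - b) / a) - b) *
      (x ^ (1 - α) * (1 - b ^ (1 - α)) / (α - 1) + lam * x * (1 - b))

/-- The solution of `c(x) - ρ W(x) + a W'(x) = 0` with value `w` at `x = 1`. -/
def Wtilde (ρ a α lam w x : ℝ) : ℝ :=
  Real.exp (ρ / a * (x - 1)) * (lam / ρ + lam * a / ρ ^ 2 + 1 / (ρ * (α - 1)) + w)
    - x ^ (1 - α) / (ρ * (α - 1)) - lam / ρ * x - a * lam / ρ ^ 2
    - Real.exp (ρ / a * x) / ρ * expInt ρ a α 1 x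

/-- The initial value `w₁` belonging to the threshold `xb`. -/
def w1 (ρ a b α lam xb : ℝ) : ℝ :=
  Real.exp (ρ / a) / ρ * expInt ρ a α 1 xb - lam * (ρ + a) / ρ ^ 2 - 1 / (ρ * (α - 1))
    - (xb ^ (1 - α) * (1 - b ^ (1 - α)) / (ρ * (α - 1)) + (1 - b) * lam * xb / ρ
        + Real.exp (ρ * b * xb / a) / ρ * expInt ρ a α (b * xb) xb)
      / (Real.exp ((ρ * b * xb - ρ) / a) - Real.exp ((ρ * xb - ρ) / a))

/-- The number `i` with `x ∈ [xb / b ^ (i - 1), xb / b ^ i)`, for `x ≥ xb`. -/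
def thresholdImpulse (b xb x : ℝ) : ℕ+ :=
  Classical.epsilon fun i : ℕ+ => x ∈ Ico (xb / b ^ ((i : ℕ) - 1)) (xb / b ^ (i : ℕ))

/-- The function equal to `Wtilde` (with the initial value `w1`) on `(0, xb)` and extended through
`W x = W (b x)` to `[xb, xb / b)`, `[xb / b, xb / b ^ 2)`, …; the recursion is unrolled: on the
`i`-th of these intervals it leads to `W x = Wtilde (b ^ i x)`. -/
def W (ρ a b α lam xb x : ℝ) : ℝ :=
  if x < xb then Wtilde ρ a α lam (w1 ρ a b α lam xb) x
  else Wtilde ρ a α lam (w1 ρ a b α lam xb) (b ^ (thresholdImpulse b xb x : ℕ) * x)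

end AIMD

end

/-!
Write `c` for the reward rate. The solutions `Wtilde w` of the flow equation `c - ρ W + a W' = 0`
form a one-parameter family increasing in `w`, and `w1 y` is the parameter for which `Wtilde w`
takes the same value at `y` and `b y`; thus `w1 y` measures the quality of the threshold `y`
(`Wtilde_sub_scaled`). Its derivative has the sign of `H` (`w1_hasDerivAt`), so a zero of `H` with a
sign change from plus to minus is the best threshold.

*The zero of `H`.* The function `F x = exp (-(ρ / a) x) H x` tends to `0` at `0` and at infinity,
and `F'` is a positive function times `slopeFactor`, which first decreases and then increases.
Hence `F` increases from `0`, decreases, and increases back to `0`: it is positive, then negative,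
with one zero `xb` (`exists_H_sign_change`). Consequently `w1` increases on `(0, xb]` and decreases
on `[xb, ∞)`.

*The Bellman equation.* That `xb` maximizes `w1` says `Wtilde (b x) ≤ Wtilde x` for all `x > 0`,
which gives `W (b ^ i x) ≤ W x`. The flow inequality beyond `xb` follows by induction on the number
of contractions that lead below the threshold, from the monotonicity of `w1` on `[xb, ∞)`
(`flow_nonpos_of_w1_le`). The equation `H xb = 0` is the smooth fit at `xb`, and differentiability
elsewhere is inherited through `W x = W (b x)`.

*Optimality.* Along a controlled process, the integral of the discounted reward up to time `t` is
at most `W x₀ - exp (-ρ t) W (x t)`, by the Bellman inequality on each interval between impulses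
(`IsProcess.integral_le`, `integral_segment_le`), with equality under the threshold policy. Since
`W` is bounded (near `0` because `α < 2`), the last term vanishes as `t → ∞`. The threshold policy
exists because from the second impulse on the time between impulses is a positive constant.
-/

open Set Filter Topology MeasureTheory

namespace AIMD

/-! ### The flow equation and the parameter `w1` -/

variable {ρ a b α lam : ℝ}

theorem rewardRate_hasDerivAt (hα : 1 < α) {x : ℝ} (hx : 0 < x) :
    HasDerivAt (rewardRate α lam) (x ^ (-α) - lam) x := by
  have h1 := (Real.hasDerivAt_rpow_const (p := 1 - α) (Or.inl hx.ne')).div_const (1 - α)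
  have h2 := (hasDerivAt_id x).const_mul lam
  refine (h1.sub h2).congr_deriv ?_
  rw [mul_div_cancel_left₀ _ (by linarith : 1 - α ≠ 0), mul_one]
  congr 2
  ring

theorem rewardRate_nonpos (hα : 1 < α) (hlam : 0 < lam) {x : ℝ} (hx : 0 < x) :
    rewardRate α lam x ≤ 0 := by
  have h1 : x ^ (1 - α) / (1 - α) ≤ 0 :=
    div_nonpos_of_nonneg_of_nonpos (by positivity) (by linarith)
  have h2 : 0 < lam * x := by positivity
  unfold rewardRate
  linarith

theorem expInt_hasDerivAt {p x : ℝ} (hp : 0 < p) (hx : 0 < x) :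
    HasDerivAt (fun q => expInt ρ a α p q) (Real.exp (-(ρ * x / a)) * x ^ (-α)) x := by
  have hc : ContinuousOn (fun u : ℝ => Real.exp (-(ρ * u / a)) * u ^ (-α)) (Ioi 0) :=
    (Continuous.continuousOn (by fun_prop)).mul
      (continuousOn_id.rpow_const fun u hu => Or.inl (ne_of_gt hu))
  refine intervalIntegral.integral_hasDerivAt_right ?_ ?_ ?_
  · refine (hc.mono fun u hu => ?_).intervalIntegrable
    exact lt_of_lt_of_le (lt_min hp hx) hu.1
  · exact hc.stronglyMeasurableAtFilter isOpen_Ioi x hx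
  · exact hc.continuousAt (isOpen_Ioi.mem_nhds hx)

theorem expInt_sub {p q : ℝ} (hp : 0 < p) (hq : 0 < q) :
    expInt ρ a α p q = expInt ρ a α 1 q - expInt ρ a α 1 p := by
  have hc : ContinuousOn (fun u : ℝ => Real.exp (-(ρ * u / a)) * u ^ (-α)) (Ioi 0) :=
    (Continuous.continuousOn (by fun_prop)).mul
      (continuousOn_id.rpow_const fun u hu => Or.inl (ne_of_gt hu))
  have hi : ∀ s t : ℝ, 0 < s → 0 < t → IntervalIntegrable
      (fun u : ℝ => Real.exp (-(ρ * u / a)) * u ^ (-α)) volume s t := fun s t hs ht =>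
    (hc.mono fun u hu => lt_of_lt_of_le (lt_min hs ht) hu.1).intervalIntegrable
  unfold expInt
  rw [intervalIntegral.integral_interval_sub_left (hi _ _ one_pos hq) (hi _ _ one_pos hp)]

/-- `Wtilde` solves the linear equation `c - ρ W + a W' = 0`. -/
theorem Wtilde_hasDerivAt (hρ : 0 < ρ) (ha : 0 < a) (hα : 1 < α) (w : ℝ) {x : ℝ} (hx : 0 < x) :
    HasDerivAt (Wtilde ρ a α lam w)
      ((ρ * Wtilde ρ a α lam w x - rewardRate α lam x) / a) x := by
  have h1 : HasDerivAt (fun x : ℝ => Real.exp (ρ / a * (x - 1)))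
      (Real.exp (ρ / a * (x - 1)) * (ρ / a)) x := by
    simpa using (((hasDerivAt_id x).sub_const 1).const_mul (ρ / a)).exp
  have h2 : HasDerivAt (fun x : ℝ => Real.exp (ρ / a * x))
      (Real.exp (ρ / a * x) * (ρ / a)) x := by
    simpa using ((hasDerivAt_id x).const_mul (ρ / a)).exp
  have h3 := Real.hasDerivAt_rpow_const (p := 1 - α) (Or.inl hx.ne')
  have h4 := expInt_hasDerivAt (ρ := ρ) (a := a) (α := α) one_pos hx
  have h5 := (hasDerivAt_id x).const_mul (lam / ρ)
  have h := ((((h1.mul_const (lam / ρ + lam * a / ρ ^ 2 + 1 / (ρ * (α - 1)) + w)).sub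
    (h3.div_const (ρ * (α - 1)))).sub h5).sub_const (a * lam / ρ ^ 2)).sub
    ((h2.div_const ρ).mul h4)
  refine h.congr_deriv ?_
  have e1 : x ^ (1 - α - 1) = x ^ (-α) := by congr 1; ring
  have e2 : Real.exp (-(ρ * x / a)) = (Real.exp (ρ / a * x))⁻¹ := by
    rw [← Real.exp_neg]; congr 1; ring
  have e0 := (Real.exp_pos (ρ / a * x)).ne'
  have hα' : α - 1 ≠ 0 := by linarith
  have hα'' : 1 - α ≠ 0 := by linarith
  have e3 : x ^ (1 - α) / (1 - α) = - (x ^ (1 - α) / (α - 1)) := by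
    rw [← neg_sub α 1, div_neg]
  rw [e1, e2]
  unfold Wtilde rewardRate
  rw [e3]
  field_simp
  ring

theorem Wtilde_sub_param (w w' x : ℝ) :
    Wtilde ρ a α lam w x - Wtilde ρ a α lam w' x = Real.exp (ρ / a * (x - 1)) * (w - w') := by
  unfold Wtilde
  ring

/-- The quantity `w1 y` is exactly the parameter `w` for which the solution `Wtilde w` takes the
same value at `y` and at `b y`; in general the gap is proportional to `w - w1 y`. -/
theorem Wtilde_sub_scaled (hρ : 0 < ρ) (ha : 0 < a) (hb0 : 0 < b) (hb1 : b < 1) (hα : 1 < α)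
    (w : ℝ) {x : ℝ} (hx : 0 < x) :
    Wtilde ρ a α lam w x - Wtilde ρ a α lam w (b * x) =
      (Real.exp (ρ / a * (x - 1)) - Real.exp (ρ / a * (b * x - 1))) *
        (w - w1 ρ a b α lam x) := by
  have hbx : 0 < b * x := by positivity
  have hlt : Real.exp (ρ / a * (b * x)) < Real.exp (ρ / a * x) := by
    apply Real.exp_lt_exp.2
    exact mul_lt_mul_of_pos_left (by nlinarith) (by positivity)
  have f1 : Real.exp (ρ / a * (x - 1)) = Real.exp (ρ / a * x) / Real.exp (ρ / a) := by
    rw [← Real.exp_sub]; congr 1; ring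
  have f2 : Real.exp (ρ / a * (b * x - 1)) = Real.exp (ρ / a * (b * x)) / Real.exp (ρ / a) := by
    rw [← Real.exp_sub]; congr 1; ring
  have f3 : Real.exp ((ρ * b * x - ρ) / a) = Real.exp (ρ / a * (b * x)) / Real.exp (ρ / a) := by
    rw [← Real.exp_sub]; congr 1; ring
  have f4 : Real.exp ((ρ * x - ρ) / a) = Real.exp (ρ / a * x) / Real.exp (ρ / a) := by
    rw [← Real.exp_sub]; congr 1; ring
  have f5 : Real.exp (ρ * b * x / a) = Real.exp (ρ / a * (b * x)) := by congr 1; ring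
  have f6 : (b * x) ^ (1 - α) = b ^ (1 - α) * x ^ (1 - α) := Real.mul_rpow hb0.le hx.le
  unfold Wtilde w1
  rw [f1, f2, f3, f4, f5, f6, expInt_sub hbx hx]
  generalize Real.exp (ρ / a * x) = X at *
  generalize Real.exp (ρ / a * (b * x)) = B at *
  have hR := (Real.exp_pos (ρ / a)).ne'
  generalize Real.exp (ρ / a) = R at *
  have hα' : α - 1 ≠ 0 := by linarith
  have hBX : B - X ≠ 0 := by linarith
  have : B / R - X / R ≠ 0 := by
    rw [← sub_div]; exact div_ne_zero hBX hR
  field_simp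
  ring

/-- The discounted form of `H`, with the integral eliminated in favour of a solution `Wtilde w` of
the flow equation; this identity holds for each `w`. -/
theorem exp_neg_mul_H (hρ : 0 < ρ) (hb0 : 0 < b) (hα : 1 < α)
    (w : ℝ) {x : ℝ} (hx : 0 < x) :
    Real.exp (-(ρ / a * x)) * H ρ a b α lam x =
      ρ * (1 - b) * (Real.exp (-(ρ / a * x)) * Wtilde ρ a α lam w x
          - Real.exp (-(ρ / a * (b * x))) * Wtilde ρ a α lam w (b * x))
        + (rewardRate α lam x - b * rewardRate α lam (b * x)) *
          (Real.exp (-(ρ / a * (b * x))) - Real.exp (-(ρ / a * x))) := by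
  have hbx : 0 < b * x := by positivity
  have f1 : Real.exp (ρ / a * (x - 1)) = Real.exp (ρ / a * x) / Real.exp (ρ / a) := by
    rw [← Real.exp_sub]; congr 1; ring
  have f2 : Real.exp (ρ / a * (b * x - 1)) = Real.exp (ρ / a * (b * x)) / Real.exp (ρ / a) := by
    rw [← Real.exp_sub]; congr 1; ring
  have f3 : Real.exp (ρ * x * (1 - b) / a) =
      Real.exp (ρ / a * x) / Real.exp (ρ / a * (b * x)) := by
    rw [← Real.exp_sub]; congr 1; ring
  have f4 : Real.exp (ρ * x / a) = Real.exp (ρ / a * x) := by congr 1; ring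
  have f6 : (b * x) ^ (1 - α) = b ^ (1 - α) * x ^ (1 - α) := Real.mul_rpow hb0.le hx.le
  unfold Wtilde H rewardRate
  rw [Real.exp_neg, Real.exp_neg, f1, f2, f3, f4, f6, expInt_sub hbx hx]
  have hX := (Real.exp_pos (ρ / a * x)).ne'
  have hB := (Real.exp_pos (ρ / a * (b * x))).ne'
  have hR := (Real.exp_pos (ρ / a)).ne'
  generalize Real.exp (ρ / a * x) = X at *
  generalize Real.exp (ρ / a * (b * x)) = B at *
  generalize Real.exp (ρ / a) = R at *
  have hα' : α - 1 ≠ 0 := by linarith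
  have e3 : ∀ z : ℝ, z / (1 - α) = - (z / (α - 1)) := fun z => by
    rw [← neg_sub α 1, div_neg]
  rw [e3, e3]
  field_simp
  ring

theorem exp_neg_mul_Wtilde_hasDerivAt (hρ : 0 < ρ) (ha : 0 < a) (hα : 1 < α) (w : ℝ) {x : ℝ}
    (hx : 0 < x) :
    HasDerivAt (fun x => Real.exp (-(ρ / a * x)) * Wtilde ρ a α lam w x)
      (-(Real.exp (-(ρ / a * x)) * rewardRate α lam x / a)) x := by
  have h1 : HasDerivAt (fun x : ℝ => Real.exp (-(ρ / a * x)))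
      (Real.exp (-(ρ / a * x)) * (-(ρ / a))) x := by
    simpa using ((hasDerivAt_id x).const_mul (ρ / a)).neg.exp
  refine (h1.mul (Wtilde_hasDerivAt hρ ha hα w hx)).congr_deriv ?_
  field_simp
  ring

/-- Up to a positive factor, the derivative of `exp (-(ρ / a) x) H x`. -/
noncomputable def slopeFactor (ρ a b α lam x : ℝ) : ℝ :=
  x ^ (-α) * (1 - b ^ (2 - α)) - lam * (1 - b ^ 2)
    + ρ / a * b * (x ^ (1 - α) * (1 - b ^ (1 - α)) / (α - 1) + lam * x * (1 - b))

theorem exp_neg_mul_H_hasDerivAt (hρ : 0 < ρ) (ha : 0 < a) (hb0 : 0 < b) (hα : 1 < α)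
    {x : ℝ} (hx : 0 < x) :
    HasDerivAt (fun x => Real.exp (-(ρ / a * x)) * H ρ a b α lam x)
      ((Real.exp (-(ρ / a * (b * x))) - Real.exp (-(ρ / a * x))) * slopeFactor ρ a b α lam x)
      x := by
  have hbx : 0 < b * x := by positivity
  have hb : HasDerivAt (fun x : ℝ => b * x) b x := by
    simpa using (hasDerivAt_id x).const_mul b
  have hY := exp_neg_mul_Wtilde_hasDerivAt (lam := lam) hρ ha hα 0 hx
  have hYb := (exp_neg_mul_Wtilde_hasDerivAt (lam := lam) hρ ha hα 0 hbx).comp x hb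
  have hc := rewardRate_hasDerivAt (lam := lam) hα hx
  have hcb := (rewardRate_hasDerivAt (lam := lam) hα hbx).comp x hb
  have he : ∀ y : ℝ, HasDerivAt (fun x : ℝ => Real.exp (-(ρ / a * x)))
      (Real.exp (-(ρ / a * y)) * (-(ρ / a))) y := fun y => by
    simpa using ((hasDerivAt_id y).const_mul (ρ / a)).neg.exp
  have heb := (he (b * x)).comp x hb
  have h := ((hY.sub hYb).const_mul (ρ * (1 - b))).add
    ((hc.sub (hcb.const_mul b)).mul (heb.sub (he x)))
  have h' := h.congr_of_eventuallyEq (f₁ := fun x => Real.exp (-(ρ / a * x)) * H ρ a b α lam x) (by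
    filter_upwards [isOpen_Ioi.mem_nhds hx] with y hy
    exact exp_neg_mul_H hρ hb0 hα 0 hy)
  refine h'.congr_deriv ?_
  have f6 : (b * x) ^ (1 - α) = b ^ (1 - α) * x ^ (1 - α) := Real.mul_rpow hb0.le hx.le
  have f7 : (b * x) ^ (-α) = b ^ (-α) * x ^ (-α) := Real.mul_rpow hb0.le hx.le
  have f8 : b ^ (2 - α) = b ^ 2 * b ^ (-α) := by
    rw [sub_eq_add_neg, Real.rpow_add hb0]; norm_num
  have e3 : ∀ z : ℝ, z / (1 - α) = - (z / (α - 1)) := fun z => by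
    rw [← neg_sub α 1, div_neg]
  have hα' : α - 1 ≠ 0 := by linarith
  simp only [Function.comp_apply, Pi.sub_apply]
  unfold slopeFactor rewardRate
  rw [f6, f7, f8, e3, e3]
  field_simp
  ring

end AIMD

namespace AIMD

/-! ### The sign of `H` and the monotonicity of `w1` -/

variable {ρ a b α lam : ℝ}

/-- By the mean value theorem for `exp (-(ρ / a) x) Wtilde x`, the discounted form of `H` is bounded
by a function that tends to `0` both at `0` (as `α < 2`) and at infinity. -/
theorem abs_exp_neg_mul_H_le (hρ : 0 < ρ) (ha : 0 < a) (hb0 : 0 < b) (hb1 : b < 1) (hα : 1 < α)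
    (hlam : 0 < lam) {x : ℝ} (hx : 0 < x) :
    |Real.exp (-(ρ / a * x)) * H ρ a b α lam x| ≤
      2 * (ρ / a) * (1 - b) * ((b ^ (1 - α) / (α - 1) * x ^ (2 - α) + lam * x ^ 2) *
        Real.exp (-(ρ / a * b) * x)) := by
  have hbx : 0 < b * x := by positivity
  have hbx1 : b * x ≤ x := by nlinarith
  have hr : 0 < ρ / a := by positivity
  have hα' : 0 < α - 1 := by linarith
  -- a bound for `|c|` on `[b x, x]`
  set M := (b * x) ^ (1 - α) / (α - 1) + lam * x with hM
  set B := Real.exp (-(ρ / a * (b * x))) with hB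
  have hB0 : 0 < B := Real.exp_pos _
  have hM0 : 0 < M := by positivity
  have hc : ∀ u, b * x ≤ u → u ≤ x → |rewardRate α lam u| ≤ M := fun u h1 h2 => by
    have hu : 0 < u := hbx.trans_le h1
    rw [abs_of_nonpos (rewardRate_nonpos hα hlam hu)]
    have h3 : u ^ (1 - α) ≤ (b * x) ^ (1 - α) :=
      Real.rpow_le_rpow_of_nonpos hbx h1 (by linarith)
    have h4 : u ^ (1 - α) / (α - 1) ≤ (b * x) ^ (1 - α) / (α - 1) := by gcongr
    have h5 : lam * u ≤ lam * x := by gcongr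
    have h6 : u ^ (1 - α) / (1 - α) = -(u ^ (1 - α) / (α - 1)) := by
      rw [← neg_sub α 1, div_neg]
    unfold rewardRate
    rw [h6]
    linarith
  have hY : |Real.exp (-(ρ / a * x)) * Wtilde ρ a α lam 0 x - B * Wtilde ρ a α lam 0 (b * x)| ≤
      B * M / a * (x - b * x) := by
    have := Convex.norm_image_sub_le_of_norm_hasDerivWithin_le
      (f := fun x => Real.exp (-(ρ / a * x)) * Wtilde ρ a α lam 0 x)
      (f' := fun x => -(Real.exp (-(ρ / a * x)) * rewardRate α lam x / a))
      (s := Icc (b * x) x) (C := B * M / a) (x := b * x) (y := x)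
      (fun u hu => (exp_neg_mul_Wtilde_hasDerivAt hρ ha hα 0
        (hbx.trans_le hu.1)).hasDerivWithinAt)
      (fun u hu => by
        rw [norm_neg, Real.norm_eq_abs, abs_div, abs_mul, abs_of_pos ha,
          abs_of_pos (Real.exp_pos _)]
        have := hc u hu.1 hu.2
        have h7 : Real.exp (-(ρ / a * u)) ≤ B :=
          Real.exp_le_exp.2 (neg_le_neg (mul_le_mul_of_nonneg_left hu.1 hr.le))
        gcongr)
      (convex_Icc _ _) (left_mem_Icc.2 hbx1) (right_mem_Icc.2 hbx1)
    simpa [Real.norm_eq_abs, abs_of_nonneg (sub_nonneg.2 hbx1)] using this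
  have hc2 : |rewardRate α lam x - b * rewardRate α lam (b * x)| ≤ (1 + b) * M := by
    have h1 := abs_le.1 (hc x hbx1 le_rfl)
    have h2 := abs_le.1 (hc (b * x) le_rfl hbx1)
    rw [abs_le]
    constructor <;> nlinarith
  have hD : |B - Real.exp (-(ρ / a * x))| ≤ B * (ρ / a * (1 - b) * x) := by
    have h1 : Real.exp (-(ρ / a * x)) = B * Real.exp (-(ρ / a * (1 - b) * x)) := by
      rw [hB, ← Real.exp_add]; congr 1; ring
    have h2 := Real.add_one_le_exp (-(ρ / a * (1 - b) * x))
    have h3 : Real.exp (-(ρ / a * (1 - b) * x)) ≤ 1 := by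
      apply Real.exp_le_one_iff.2
      have : 0 < ρ / a * (1 - b) * x := by have : 0 < 1 - b := by linarith
                                           positivity
      linarith
    rw [h1, abs_of_nonneg (by nlinarith)]
    nlinarith
  have e1 : (b ^ (1 - α) / (α - 1) * x ^ (2 - α) + lam * x ^ 2) = x * M := by
    rw [hM, Real.mul_rpow hb0.le hx.le, show (2 - α) = 1 + (1 - α) by ring, Real.rpow_add hx,
      Real.rpow_one]
    ring
  have e2 : Real.exp (-(ρ / a * b) * x) = B := by rw [hB]; congr 1; ring
  rw [exp_neg_mul_H hρ hb0 hα 0 hx, e1, e2]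
  have hb' : 0 < 1 - b := by linarith
  calc _ ≤ ρ * (1 - b) * (B * M / a * (x - b * x)) +
        (1 + b) * M * (B * (ρ / a * (1 - b) * x)) := by
        refine (abs_add_le _ _).trans ?_
        rw [abs_mul, abs_mul _ (B - _), abs_of_nonneg (by positivity : 0 ≤ ρ * (1 - b))]
        gcongr
    _ = _ := by field_simp; ring

theorem tendsto_exp_neg_mul_H_zero (hρ : 0 < ρ) (ha : 0 < a) (hb0 : 0 < b) (hb1 : b < 1)
    (hα : 1 < α) (hα2 : α < 2) (hlam : 0 < lam) :
    Tendsto (fun x => Real.exp (-(ρ / a * x)) * H ρ a b α lam x) (𝓝[>] 0) (𝓝 0) := by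
  have hcont : Continuous fun x : ℝ => 2 * (ρ / a) * (1 - b) *
      ((b ^ (1 - α) / (α - 1) * x ^ (2 - α) + lam * x ^ 2) * Real.exp (-(ρ / a * b) * x)) := by
    have : Continuous fun x : ℝ => x ^ (2 - α) := Real.continuous_rpow_const (by linarith)
    fun_prop
  have h0 := (hcont.tendsto 0).mono_left (nhdsWithin_le_nhds (s := Ioi 0))
  have hz : (0 : ℝ) ^ (2 - α) = 0 := Real.zero_rpow (by linarith)
  simp only [hz] at h0
  norm_num at h0
  refine squeeze_zero_norm' ?_ h0
  filter_upwards [self_mem_nhdsWithin] with x hx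
  simpa using abs_exp_neg_mul_H_le hρ ha hb0 hb1 hα hlam hx

theorem tendsto_exp_neg_mul_H_atTop (hρ : 0 < ρ) (ha : 0 < a) (hb0 : 0 < b) (hb1 : b < 1)
    (hα : 1 < α) (hlam : 0 < lam) :
    Tendsto (fun x => Real.exp (-(ρ / a * x)) * H ρ a b α lam x) atTop (𝓝 0) := by
  have hk : 0 < ρ / a * b := by positivity
  have h1 := tendsto_rpow_mul_exp_neg_mul_atTop_nhds_zero (2 - α) _ hk
  have h2 := tendsto_rpow_mul_exp_neg_mul_atTop_nhds_zero 2 _ hk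
  have h := ((h1.const_mul (b ^ (1 - α) / (α - 1))).add (h2.const_mul lam)).const_mul
    (2 * (ρ / a) * (1 - b))
  simp only [mul_zero, add_zero] at h
  refine squeeze_zero_norm' ?_ h
  filter_upwards [eventually_gt_atTop 0] with x hx
  refine (abs_exp_neg_mul_H_le hρ ha hb0 hb1 hα hlam hx).trans_eq ?_
  norm_num
  left
  ring

theorem pos_of_strictMonoOn_of_tendsto {f : ℝ → ℝ} {z : ℝ} (hf : StrictMonoOn f (Ioc 0 z))
    (h0 : Tendsto f (𝓝[>] 0) (𝓝 0)) {x : ℝ} (hx : x ∈ Ioc 0 z) : 0 < f x := by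
  have hx2 : x / 2 ∈ Ioc 0 z := ⟨by linarith [hx.1], by linarith [hx.1, hx.2]⟩
  have h1 : f (x / 2) < f x := hf hx2 hx (by linarith [hx.1])
  refine lt_of_le_of_lt (le_of_tendsto h0 ?_) h1
  filter_upwards [Ioo_mem_nhdsGT hx2.1] with y hy
  exact (hf ⟨hy.1, hy.2.le.trans hx2.2⟩ hx2 hy.2).le

theorem neg_of_strictMonoOn_of_tendsto {f : ℝ → ℝ} {z : ℝ} (hf : StrictMonoOn f (Ici z))
    (h0 : Tendsto f atTop (𝓝 0)) {x : ℝ} (hx : z ≤ x) : f x < 0 := by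
  have hx2 : z ≤ x + 1 := by linarith
  have h1 : f x < f (x + 1) := hf hx hx2 (by linarith)
  refine lt_of_lt_of_le h1 (ge_of_tendsto h0 ?_)
  filter_upwards [eventually_gt_atTop (x + 1)] with y hy
  exact (hf hx2 (hx2.trans hy.le) hy).le

theorem slopeFactor_hasDerivAt (hα : 1 < α) {x : ℝ} (hx : 0 < x) :
    HasDerivAt (slopeFactor ρ a b α lam)
      (x ^ (-α - 1) * (-(α * (1 - b ^ (2 - α))) + ρ / a * b * (b ^ (1 - α) - 1) * x
        + ρ / a * b * lam * (1 - b) * x ^ (α + 1))) x := by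
  have h1 := Real.hasDerivAt_rpow_const (p := -α) (Or.inl hx.ne')
  have h2 := Real.hasDerivAt_rpow_const (p := 1 - α) (Or.inl hx.ne')
  have h3 : HasDerivAt (fun x : ℝ => lam * x * (1 - b)) (lam * (1 - b)) x := by
    simpa using ((hasDerivAt_id x).const_mul lam).mul_const (1 - b)
  have h := ((h1.mul_const (1 - b ^ (2 - α))).sub_const (lam * (1 - b ^ 2))).add
    ((((h2.mul_const (1 - b ^ (1 - α))).div_const (α - 1)).add h3).const_mul (ρ / a * b))
  refine h.congr_deriv ?_
  have e1 : x ^ (1 - α - 1) = x ^ (-α - 1) * x := by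
    rw [← Real.rpow_add_one hx.ne']; congr 1; ring
  have e2 : x ^ (-α - 1) * x ^ (α + 1) = 1 := by
    rw [← Real.rpow_add hx]; norm_num
  have hα' : α - 1 ≠ 0 := by linarith
  rw [e1]
  have e3 : ρ / a * b * (lam * (1 - b)) =
      ρ / a * b * (lam * (1 - b)) * (x ^ (-α - 1) * x ^ (α + 1)) := by rw [e2, mul_one]
  rw [mul_add, e3]
  generalize x ^ (-α - 1) = p
  field_simp
  ring

/-- `slopeFactor` is first strictly decreasing and then strictly increasing: its derivative has the
sign of a strictly increasing function which is negative at `0` and unbounded above. -/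
theorem exists_slopeFactor_turning (hρ : 0 < ρ) (ha : 0 < a) (hb0 : 0 < b) (hb1 : b < 1)
    (hα : 1 < α) (hα2 : α < 2) (hlam : 0 < lam) :
    ∃ m, 0 < m ∧ StrictAntiOn (slopeFactor ρ a b α lam) (Ioc 0 m) ∧
      StrictMonoOn (slopeFactor ρ a b α lam) (Ici m) := by
  set S : ℝ → ℝ := fun x => -(α * (1 - b ^ (2 - α))) + ρ / a * b * (b ^ (1 - α) - 1) * x
        + ρ / a * b * lam * (1 - b) * x ^ (α + 1) with hS
  have hA : 0 < 1 - b ^ (2 - α) := sub_pos.2 (Real.rpow_lt_one hb0.le hb1 (by linarith))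
  have hB : 0 < b ^ (1 - α) - 1 :=
    sub_pos.2 (Real.one_lt_rpow_of_pos_of_lt_one_of_neg hb0 hb1 (by linarith))
  have hb' : 0 < 1 - b := by linarith
  have hSm : StrictMonoOn S (Ici 0) := fun x hx y hy hxy => by
    have h1 : x ^ (α + 1) ≤ y ^ (α + 1) := Real.rpow_le_rpow hx hxy.le (by linarith)
    have h2 : ρ / a * b * (b ^ (1 - α) - 1) * x < ρ / a * b * (b ^ (1 - α) - 1) * y := by
      gcongr
    have h3 : ρ / a * b * lam * (1 - b) * x ^ (α + 1) ≤
      ρ / a * b * lam * (1 - b) * y ^ (α + 1) := by gcongr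
    simp only [hS]
    linarith
  have hSc : Continuous S := by
    have : Continuous fun x : ℝ => x ^ (α + 1) := Real.continuous_rpow_const (by linarith)
    fun_prop
  have hS0 : S 0 < 0 := by
    have : (0 : ℝ) ^ (α + 1) = 0 := Real.zero_rpow (by linarith)
    simp only [hS, this]
    have : 0 < α * (1 - b ^ (2 - α)) := by positivity
    linarith
  set K := ρ / a * b * (b ^ (1 - α) - 1) with hK
  have hK0 : 0 < K := by positivity
  set X := α * (1 - b ^ (2 - α)) / K with hX
  have hX0 : 0 < X := by positivity
  have hSX : 0 < S X := by
    have h1 : K * X = α * (1 - b ^ (2 - α)) := by rw [hX]; field_simp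
    have h2 : 0 < ρ / a * b * lam * (1 - b) * X ^ (α + 1) := by positivity
    simp only [hS]
    rw [h1]
    linarith
  obtain ⟨m, hm, hm0⟩ := intermediate_value_Ioo hX0.le hSc.continuousOn ⟨hS0, hSX⟩
  have hcont : ContinuousOn (slopeFactor ρ a b α lam) (Ioi 0) := fun x hx =>
    (slopeFactor_hasDerivAt hα hx).continuousAt.continuousWithinAt
  refine ⟨m, hm.1, ?_, ?_⟩
  · refine strictAntiOn_of_deriv_neg (convex_Ioc _ _) (hcont.mono fun x hx => hx.1)
      fun x hx => ?_
    rw [interior_Ioc] at hx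
    rw [(slopeFactor_hasDerivAt hα hx.1).deriv]
    exact mul_neg_of_pos_of_neg (Real.rpow_pos_of_pos hx.1 _)
      (hm0 ▸ hSm hx.1.le hm.1.le hx.2)
  · refine strictMonoOn_of_deriv_pos (convex_Ici _)
      (hcont.mono fun x hx => hm.1.trans_le hx) fun x hx => ?_
    rw [interior_Ici] at hx
    have hx0 : 0 < x := hm.1.trans hx
    rw [(slopeFactor_hasDerivAt hα hx0).deriv]
    exact mul_pos (Real.rpow_pos_of_pos hx0 _) (hm0 ▸ hSm hm.1.le hx0.le hx)

theorem eventually_slopeFactor_pos_zero (hα : 1 < α) (hα2 : α < 2) (hb0 : 0 < b) (hb1 : b < 1) :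
    ∀ᶠ x in 𝓝[>] 0, 0 < slopeFactor ρ a b α lam x := by
  have hA : 0 < 1 - b ^ (2 - α) := sub_pos.2 (Real.rpow_lt_one hb0.le hb1 (by linarith))
  have hcont : Continuous fun x : ℝ => (1 - b ^ (2 - α)) - lam * (1 - b ^ 2) * x ^ α
      + ρ / a * b * (x * (1 - b ^ (1 - α)) / (α - 1) + lam * x * (1 - b) * x ^ α) := by
    have : Continuous fun x : ℝ => x ^ α := Real.continuous_rpow_const (by linarith)
    fun_prop
  have hz : (0 : ℝ) ^ α = 0 := Real.zero_rpow (by linarith)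
  have := (hcont.tendsto 0).eventually (lt_mem_nhds (a := 0) (by simpa [hz] using hA))
  filter_upwards [self_mem_nhdsWithin, this.filter_mono nhdsWithin_le_nhds] with x hx h
  have hx : 0 < x := hx
  have e1 : x ^ (-α) * x ^ α = 1 := by rw [← Real.rpow_add hx]; norm_num
  have e2 : x ^ (1 - α) = x ^ (-α) * x := by
    rw [← Real.rpow_add_one hx.ne']; congr 1; ring
  refine (mul_pos (Real.rpow_pos_of_pos hx (-α)) h).trans_eq ?_
  unfold slopeFactor
  rw [e2]
  linear_combination (-lam * (1 - b ^ 2) + ρ / a * b * lam * x * (1 - b)) * e1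

theorem exists_slopeFactor_pos (hρ : 0 < ρ) (ha : 0 < a) (hb0 : 0 < b) (hb1 : b < 1)
    (hα : 1 < α) (hα2 : α < 2) (hlam : 0 < lam) (m : ℝ) :
    ∃ x, m < x ∧ 0 < slopeFactor ρ a b α lam x := by
  have hb' : 0 < 1 - b := by linarith
  have hB : 0 < b ^ (1 - α) - 1 :=
    sub_pos.2 (Real.one_lt_rpow_of_pos_of_lt_one_of_neg hb0 hb1 (by linarith))
  have hα' : 0 < α - 1 := by linarith
  have hC : 0 < ρ / a * b * lam * (1 - b) := by positivity
  have hlim : Tendsto (fun x : ℝ => ρ / a * b * lam * (1 - b) * x) atTop atTop :=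
    tendsto_id.const_mul_atTop hC
  obtain ⟨x, hx, hx1, hxm⟩ := ((hlim.eventually_gt_atTop
    (ρ / a * b * ((b ^ (1 - α) - 1) / (α - 1)) + lam * (1 - b ^ 2))).and
    ((eventually_ge_atTop 1).and (eventually_gt_atTop m))).exists
  refine ⟨x, hxm, ?_⟩
  have hA : 0 < 1 - b ^ (2 - α) := sub_pos.2 (Real.rpow_lt_one hb0.le hb1 (by linarith))
  have h0 : 0 < x ^ (-α) * (1 - b ^ (2 - α)) := by positivity
  have h1 : x ^ (1 - α) ≤ 1 := Real.rpow_le_one_of_one_le_of_nonpos hx1 (by linarith)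
  have h2 : ρ / a * b * ((b ^ (1 - α) - 1) / (α - 1)) * x ^ (1 - α) ≤
      ρ / a * b * ((b ^ (1 - α) - 1) / (α - 1)) * 1 := by gcongr
  unfold slopeFactor
  have e : ρ / a * b * (x ^ (1 - α) * (1 - b ^ (1 - α)) / (α - 1) + lam * x * (1 - b)) =
      ρ / a * b * lam * (1 - b) * x -
        ρ / a * b * ((b ^ (1 - α) - 1) / (α - 1)) * x ^ (1 - α) := by ring
  rw [e]
  linarith

/-- `H` has exactly one sign change, from positive to negative. Its discounted form tends to `0` at
`0` and at infinity and increases, then decreases, then increases again. -/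
theorem exists_H_sign_change (hρ : 0 < ρ) (ha : 0 < a) (hb0 : 0 < b) (hb1 : b < 1)
    (hα : 1 < α) (hα2 : α < 2) (hlam : 0 < lam) :
    ∃ xb, 0 < xb ∧ H ρ a b α lam xb = 0 ∧ (∀ x, 0 < x → x < xb → 0 < H ρ a b α lam x) ∧
      ∀ x, xb < x → H ρ a b α lam x < 0 := by
  set F : ℝ → ℝ := fun x => Real.exp (-(ρ / a * x)) * H ρ a b α lam x with hF
  set Q := slopeFactor ρ a b α lam with hQ
  have hFd : ∀ x, 0 < x → HasDerivAt F
      ((Real.exp (-(ρ / a * (b * x))) - Real.exp (-(ρ / a * x))) * Q x) x := fun x hx =>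
    exp_neg_mul_H_hasDerivAt hρ ha hb0 hα hx
  have hden : ∀ x, 0 < x → 0 < Real.exp (-(ρ / a * (b * x))) - Real.exp (-(ρ / a * x)) :=
    fun x hx => by
      have hr : 0 < ρ / a := by positivity
      exact sub_pos.2 (Real.exp_lt_exp.2 (neg_lt_neg (mul_lt_mul_of_pos_left (by nlinarith) hr)))
  have hFc : ContinuousOn F (Ioi 0) := fun x hx => (hFd x hx).continuousAt.continuousWithinAt
  have hQc : ContinuousOn Q (Ioi 0) := fun x hx =>
    (slopeFactor_hasDerivAt hα hx).continuousAt.continuousWithinAt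
  have hmono : ∀ s : Set ℝ, Convex ℝ s → s ⊆ Ioi 0 → (∀ x ∈ interior s, 0 < Q x) →
      StrictMonoOn F s := fun s hs hs0 hq =>
    strictMonoOn_of_deriv_pos hs (hFc.mono hs0) fun x hx => by
      have hx0 := hs0 (interior_subset hx)
      rw [(hFd x hx0).deriv]
      exact mul_pos (hden x hx0) (hq x hx)
  have hF0 := tendsto_exp_neg_mul_H_zero (lam := lam) hρ ha hb0 hb1 hα hα2 hlam
  have hFt := tendsto_exp_neg_mul_H_atTop (lam := lam) hρ ha hb0 hb1 hα hlam
  obtain ⟨m, hm, hQa, hQm⟩ := exists_slopeFactor_turning (lam := lam) hρ ha hb0 hb1 hα hα2 hlam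
  have hQneg : Q m < 0 := by
    by_contra! hcon
    have h1 := hmono (Ioc 0 m) (convex_Ioc _ _) (fun x hx => hx.1) fun x hx => by
      rw [interior_Ioc] at hx
      exact hcon.trans_lt (hQa ⟨hx.1, hx.2.le⟩ ⟨hm, le_rfl⟩ hx.2)
    have h2 := hmono (Ici m) (convex_Ici _) (fun x hx => hm.trans_le hx) fun x hx => by
      rw [interior_Ici] at hx
      exact hcon.trans_lt (hQm self_mem_Ici (Ioi_subset_Ici_self hx) hx)
    have h3 := pos_of_strictMonoOn_of_tendsto h1 hF0 ⟨hm, le_rfl⟩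
    have h4 := neg_of_strictMonoOn_of_tendsto h2 hFt le_rfl
    linarith
  obtain ⟨s, hsm, hs0, hQs⟩ : ∃ s, s < m ∧ 0 < s ∧ 0 < Q s := by
    obtain ⟨s, h1, h2⟩ := ((eventually_slopeFactor_pos_zero (ρ := ρ) (a := a) (lam := lam) hα hα2
      hb0 hb1).and (Ioo_mem_nhdsGT hm)).exists
    exact ⟨s, h2.2, h2.1, h1⟩
  obtain ⟨t, hmt, hQt⟩ := exists_slopeFactor_pos hρ ha hb0 hb1 hα hα2 hlam m
  obtain ⟨z₁, hz₁, hQz₁⟩ := intermediate_value_Ioo' hsm.le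
    (hQc.mono fun x hx => hs0.trans_le hx.1) ⟨hQneg, hQs⟩
  obtain ⟨z₂, hz₂, hQz₂⟩ := intermediate_value_Ioo hmt.le
    (hQc.mono fun x hx => hm.trans_le hx.1) ⟨hQneg, hQt⟩
  have hz₁0 : 0 < z₁ := hs0.trans hz₁.1
  have hF1 := hmono (Ioc 0 z₁) (convex_Ioc _ _) (fun x hx => hx.1) fun x hx => by
    rw [interior_Ioc] at hx
    exact hQz₁ ▸ hQa ⟨hx.1, (hx.2.trans hz₁.2).le⟩ ⟨hz₁0, hz₁.2.le⟩ hx.2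
  have hF3 := hmono (Ici z₂) (convex_Ici _) (fun x hx => (hm.trans hz₂.1).trans_le hx)
    fun x hx => by
      rw [interior_Ici] at hx
      exact hQz₂ ▸ hQm hz₂.1.le (hz₂.1.trans hx).le hx
  have hz : z₁ < z₂ := hz₁.2.trans hz₂.1
  have hF2 : StrictAntiOn F (Icc z₁ z₂) := by
    refine strictAntiOn_of_deriv_neg (convex_Icc _ _)
      (hFc.mono fun x hx => hz₁0.trans_le hx.1) fun x hx => ?_
    rw [interior_Icc] at hx
    have hx0 := hz₁0.trans hx.1
    rw [(hFd x hx0).deriv]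
    refine mul_neg_of_pos_of_neg (hden x hx0) ?_
    rcases le_total x m with h | h
    · exact hQz₁ ▸ hQa ⟨hz₁0, hz₁.2.le⟩ ⟨hx0, h⟩ hx.1
    · exact hQz₂ ▸ hQm h hz₂.1.le hx.2
  have hFz₁ := pos_of_strictMonoOn_of_tendsto hF1 hF0 ⟨hz₁0, le_rfl⟩
  have hFz₂ := neg_of_strictMonoOn_of_tendsto hF3 hFt le_rfl
  obtain ⟨xb, hxb, hFxb⟩ := intermediate_value_Ioo' hz.le
    (hFc.mono fun x hx => hz₁0.trans_le hx.1) ⟨hFz₂, hFz₁⟩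
  have hxb' : xb ∈ Icc z₁ z₂ := Ioo_subset_Icc_self hxb
  refine ⟨xb, hz₁0.trans hxb.1, ?_, fun x hx hxx => ?_, fun x hxx => ?_⟩
  · exact (mul_eq_zero.1 hFxb).resolve_left (Real.exp_pos _).ne'
  · refine pos_of_mul_pos_right (?_ : 0 < F x) (Real.exp_pos _).le
    rcases le_total x z₁ with h | h
    · exact pos_of_strictMonoOn_of_tendsto hF1 hF0 ⟨hx, h⟩
    · exact hFxb ▸ hF2 ⟨h, hxx.le.trans hxb.2.le⟩ hxb' hxx
  · refine neg_of_mul_neg_right (?_ : F x < 0) (Real.exp_pos _).le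
    rcases le_total z₂ x with h | h
    · exact neg_of_strictMonoOn_of_tendsto hF3 hFt h
    · exact hFxb ▸ hF2 hxb' ⟨hxb.1.le.trans hxx.le, h⟩ hxx

/-- The derivative of the parameter `w1` has the sign of `H`. -/
theorem w1_hasDerivAt (hρ : 0 < ρ) (ha : 0 < a) (hb0 : 0 < b) (hb1 : b < 1) (hα : 1 < α)
    {x : ℝ} (hx : 0 < x) :
    HasDerivAt (w1 ρ a b α lam)
      (Real.exp (ρ / a * (b * x - 1)) * H ρ a b α lam x /
        (a * (Real.exp (ρ / a * (x - 1)) - Real.exp (ρ / a * (b * x - 1))) ^ 2)) x := by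
  have hgap : ∀ x, 0 < x →
      0 < Real.exp (ρ / a * (x - 1)) - Real.exp (ρ / a * (b * x - 1)) := fun x hx => by
    have hr : 0 < ρ / a := by positivity
    exact sub_pos.2 (Real.exp_lt_exp.2 (mul_lt_mul_of_pos_left (by nlinarith) hr))
  have hbx : 0 < b * x := by positivity
  have hb : HasDerivAt (fun x : ℝ => b * x) b x := by
    simpa using (hasDerivAt_id x).const_mul b
  have he : ∀ y : ℝ, HasDerivAt (fun x : ℝ => Real.exp (ρ / a * (x - 1)))
      (Real.exp (ρ / a * (y - 1)) * (ρ / a)) y := fun y => by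
    simpa using (((hasDerivAt_id y).sub_const 1).const_mul (ρ / a)).exp
  have hW := (Wtilde_hasDerivAt (lam := lam) hρ ha hα 0 hx).sub
    ((Wtilde_hasDerivAt (lam := lam) hρ ha hα 0 hbx).comp x hb)
  have hE := (he x).sub ((he (b * x)).comp x hb)
  have h := (hW.div hE (hgap x hx).ne').neg
  have h' := h.congr_of_eventuallyEq (f₁ := w1 ρ a b α lam) (by
    filter_upwards [isOpen_Ioi.mem_nhds hx] with y hy
    have h1 := Wtilde_sub_scaled (lam := lam) hρ ha hb0 hb1 hα 0 (x := y) hy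
    have h2 := (hgap y hy).ne'
    simp only [Pi.neg_apply, Pi.div_apply, Pi.sub_apply, Function.comp_apply]
    rw [h1, mul_div_cancel_left₀ _ h2]
    ring)
  refine h'.congr_deriv ?_
  have hH := exp_neg_mul_H (lam := lam) hρ hb0 hα 0 hx (a := a)
  have f1 : Real.exp (ρ / a * (x - 1)) = Real.exp (ρ / a * x) / Real.exp (ρ / a) := by
    rw [← Real.exp_sub]; congr 1; ring
  have f2 : Real.exp (ρ / a * (b * x - 1)) = Real.exp (ρ / a * (b * x)) / Real.exp (ρ / a) := by
    rw [← Real.exp_sub]; congr 1; ring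
  have h2 := (hgap x hx).ne'
  simp only [Pi.sub_apply, Function.comp_apply]
  rw [f1, f2] at h2 ⊢
  rw [Real.exp_neg, Real.exp_neg] at hH
  have hX := (Real.exp_pos (ρ / a * x)).ne'
  have hB := (Real.exp_pos (ρ / a * (b * x))).ne'
  have hR := (Real.exp_pos (ρ / a)).ne'
  generalize Real.exp (ρ / a * x) = X at *
  generalize Real.exp (ρ / a * (b * x)) = B at *
  generalize Real.exp (ρ / a) = R at *
  field_simp at hH
  have h3 : X - B ≠ 0 := fun h => h2 (by rw [← sub_div, h, zero_div])
  field_simp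
  linear_combination -hH

/-- The threshold `xb` maximizes the parameter `w1`. -/
theorem w1_monotoneOn_antitoneOn (hρ : 0 < ρ) (ha : 0 < a) (hb0 : 0 < b) (hb1 : b < 1)
    (hα : 1 < α) {xb : ℝ} (hxb : 0 < xb)
    (hpos : ∀ x, 0 < x → x < xb → 0 < H ρ a b α lam x)
    (hneg : ∀ x, xb < x → H ρ a b α lam x < 0) :
    MonotoneOn (w1 ρ a b α lam) (Ioc 0 xb) ∧ AntitoneOn (w1 ρ a b α lam) (Ici xb) := by
  have hd : ∀ x, 0 < x → HasDerivAt (w1 ρ a b α lam) _ x := fun x hx =>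
    w1_hasDerivAt hρ ha hb0 hb1 hα hx
  constructor
  · refine monotoneOn_of_deriv_nonneg (convex_Ioc _ _)
      (fun x hx => (hd x hx.1).continuousAt.continuousWithinAt)
      (fun x hx => ?_) fun x hx => ?_
    all_goals rw [interior_Ioc] at hx
    · exact (hd x hx.1).differentiableAt.differentiableWithinAt
    · rw [(hd x hx.1).deriv]
      have := (hpos x hx.1 hx.2).le
      positivity
  · refine antitoneOn_of_deriv_nonpos (convex_Ici _)
      (fun x hx => (hd x (hxb.trans_le hx)).continuousAt.continuousWithinAt)
      (fun x hx => ?_) fun x hx => ?_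
    all_goals rw [interior_Ici] at hx
    · exact (hd x (hxb.trans hx)).differentiableAt.differentiableWithinAt
    · rw [(hd x (hxb.trans hx)).deriv]
      exact div_nonpos_of_nonpos_of_nonneg
        (mul_nonpos_of_nonneg_of_nonpos (Real.exp_pos _).le (hneg x hx).le) (by positivity)

end AIMD

namespace AIMD

/-! ### The Bellman inequality -/

variable {ρ a b α lam xb : ℝ}

/-- The standing assumptions on the parameters, together with the fact that `xb` is a positive zero
of `H`. -/
structure IsThreshold (ρ a b α lam xb : ℝ) : Prop where
  hρ : 0 < ρ
  ha : 0 < a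
  hb0 : 0 < b
  hb1 : b < 1
  hα : 1 < α
  hα2 : α < 2
  hlam : 0 < lam
  pos : 0 < xb
  H_eq_zero : H ρ a b α lam xb = 0

theorem W_of_lt {x : ℝ} (hx : x < xb) :
    W ρ a b α lam xb x = Wtilde ρ a α lam (w1 ρ a b α lam xb) x := if_pos hx

namespace IsThreshold

variable (h : IsThreshold ρ a b α lam xb)

include h

theorem H_sign : (∀ x, 0 < x → x < xb → 0 < H ρ a b α lam x) ∧
    ∀ x, xb < x → H ρ a b α lam x < 0 := by
  obtain ⟨z, hz, -, h1, h2⟩ := exists_H_sign_change h.hρ h.ha h.hb0 h.hb1 h.hα h.hα2 h.hlam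
  have : z = xb := by
    rcases lt_trichotomy z xb with hlt | heq | hgt
    · exact absurd h.H_eq_zero (h2 _ hlt).ne
    · exact heq
    · exact absurd h.H_eq_zero (h1 _ h.pos hgt).ne'
  exact this ▸ ⟨h1, h2⟩

theorem w1_antitoneOn : AntitoneOn (w1 ρ a b α lam) (Ici xb) :=
  (w1_monotoneOn_antitoneOn h.hρ h.ha h.hb0 h.hb1 h.hα h.pos h.H_sign.1 h.H_sign.2).2

theorem w1_le {x : ℝ} (hx : 0 < x) : w1 ρ a b α lam x ≤ w1 ρ a b α lam xb := by
  obtain ⟨h1, h2⟩ :=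
    w1_monotoneOn_antitoneOn h.hρ h.ha h.hb0 h.hb1 h.hα h.pos h.H_sign.1 h.H_sign.2
  rcases le_total x xb with hle | hle
  · exact h1 ⟨hx, hle⟩ ⟨h.pos, le_rfl⟩ hle
  · exact h2 self_mem_Ici hle hle

theorem mul_lt {x : ℝ} (hx : 0 < x) : b * x < x := by
  nlinarith [h.hb1]

theorem Wtilde_mul_le {x : ℝ} (hx : 0 < x) :
    Wtilde ρ a α lam (w1 ρ a b α lam xb) (b * x) ≤ Wtilde ρ a α lam (w1 ρ a b α lam xb) x := by
  have h1 := Wtilde_sub_scaled (lam := lam) h.hρ h.ha h.hb0 h.hb1 h.hα (w1 ρ a b α lam xb) hx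
  have hr : 0 < ρ / a := div_pos h.hρ h.ha
  have h2 : Real.exp (ρ / a * (b * x - 1)) ≤ Real.exp (ρ / a * (x - 1)) :=
    Real.exp_le_exp.2 (mul_le_mul_of_nonneg_left (by linarith [h.mul_lt hx]) hr.le)
  have h3 := mul_nonneg (sub_nonneg.2 h2) (sub_nonneg.2 (h.w1_le hx))
  linarith

theorem Wtilde_mul_eq {x : ℝ} (hx : 0 < x) :
    Wtilde ρ a α lam (w1 ρ a b α lam x) (b * x) = Wtilde ρ a α lam (w1 ρ a b α lam x) x := by
  have h1 := Wtilde_sub_scaled (lam := lam) h.hρ h.ha h.hb0 h.hb1 h.hα (w1 ρ a b α lam x) hx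
  rw [sub_self, mul_zero] at h1
  linarith

/-- With the parameter `w1 x`, the sign of `H x` compares the slopes of `Wtilde` and of
`Wtilde (b ·)` at `x`. -/
theorem exp_neg_mul_H_eq_slope {x : ℝ} (hx : 0 < x) :
    Real.exp (-(ρ / a * x)) * H ρ a b α lam x =
      (Real.exp (-(ρ / a * (b * x))) - Real.exp (-(ρ / a * x))) *
        (b * (ρ * Wtilde ρ a α lam (w1 ρ a b α lam x) (b * x) - rewardRate α lam (b * x)) -
          (ρ * Wtilde ρ a α lam (w1 ρ a b α lam x) x - rewardRate α lam x)) := by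
  rw [exp_neg_mul_H h.hρ h.hb0 h.hα (w1 ρ a b α lam x) hx, h.Wtilde_mul_eq hx]
  ring

theorem exp_gap_pos {x : ℝ} (hx : 0 < x) :
    0 < Real.exp (-(ρ / a * (b * x))) - Real.exp (-(ρ / a * x)) :=
  sub_pos.2 (Real.exp_lt_exp.2 (neg_lt_neg
    (mul_lt_mul_of_pos_left (h.mul_lt hx) (div_pos h.hρ h.ha))))

theorem slope_le {x : ℝ} (hx : xb ≤ x) :
    b * (ρ * Wtilde ρ a α lam (w1 ρ a b α lam x) (b * x) - rewardRate α lam (b * x)) ≤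
      ρ * Wtilde ρ a α lam (w1 ρ a b α lam x) x - rewardRate α lam x := by
  have hx0 := h.pos.trans_le hx
  have hH : H ρ a b α lam x ≤ 0 := by
    rcases hx.eq_or_lt with rfl | hlt
    · exact h.H_eq_zero.le
    · exact (h.H_sign.2 x hlt).le
  have h1 := mul_nonpos_of_nonneg_of_nonpos (Real.exp_pos (-(ρ / a * x))).le hH
  rw [h.exp_neg_mul_H_eq_slope hx0] at h1
  exact sub_nonpos.1 (nonpos_of_mul_nonpos_right h1 (h.exp_gap_pos hx0))

theorem slope_eq :
    b * (ρ * Wtilde ρ a α lam (w1 ρ a b α lam xb) (b * xb) - rewardRate α lam (b * xb)) =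
      ρ * Wtilde ρ a α lam (w1 ρ a b α lam xb) xb - rewardRate α lam xb := by
  have h1 := h.exp_neg_mul_H_eq_slope h.pos
  rw [h.H_eq_zero, mul_zero] at h1
  exact sub_eq_zero.1 ((mul_eq_zero.1 h1.symm).resolve_left (h.exp_gap_pos h.pos).ne')

/-- The Bellman inequality in the impulse region, for the continuation of `Wtilde w` by `n + 1`
contractions. The left side decreases in `w`, so it is enough to take `w = w1 (b ^ n x)`, the
smallest admissible value. For it `Wtilde w` agrees at `b ^ n x` and `b ^ (n + 1) x`, and `slope_le`
compares the derivatives there, which reduces the claim to `n` contractions; since `w1` decreases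
beyond `xb`, this `w` is admissible for the induction hypothesis as well. -/
theorem flow_nonpos_of_w1_le (n : ℕ) {x w : ℝ} (hx : 0 < x) (hn : xb ≤ b ^ n * x)
    (hw : w1 ρ a b α lam (b ^ n * x) ≤ w) :
    rewardRate α lam x - ρ * Wtilde ρ a α lam w (b ^ (n + 1) * x) +
      b ^ (n + 1) * (ρ * Wtilde ρ a α lam w (b ^ (n + 1) * x) -
        rewardRate α lam (b ^ (n + 1) * x)) ≤ 0 := by
  induction n generalizing w with
  | zero =>
    rw [pow_zero, one_mul] at hn hw
    rw [zero_add, pow_one]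
    have h1 := h.slope_le hn
    have h2 := h.Wtilde_mul_eq hx
    have h3 := Wtilde_sub_param (ρ := ρ) (a := a) (α := α) (lam := lam) w (w1 ρ a b α lam x)
      (b * x)
    have h4 : 0 ≤ Real.exp (ρ / a * (b * x - 1)) * (w - w1 ρ a b α lam x) :=
      mul_nonneg (Real.exp_pos _).le (sub_nonneg.2 hw)
    have h5 : 0 ≤ ρ * (1 - b) := mul_nonneg h.hρ.le (by linarith [h.hb1])
    have h6 := mul_nonneg h5 (h3 ▸ h4)
    rw [h2] at h1 h6
    linarith
  | succ n ih =>
    have hb := h.hb0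
    set y := b ^ (n + 1) * x with hy
    have hy0 : 0 < y := by positivity
    have e1 : b ^ (n + 1 + 1) * x = b * y := by rw [hy]; ring
    have e2 : y = b * (b ^ n * x) := by rw [hy]; ring
    have hle : y < b ^ n * x := by rw [e2]; exact h.mul_lt (by positivity)
    have h0 := ih (hn.trans hle.le) (w := w1 ρ a b α lam y)
      (h.w1_antitoneOn hn (hn.trans hle.le) hle.le)
    have h1 := mul_le_mul_of_nonneg_left (h.slope_le hn) (by positivity : 0 ≤ b ^ (n + 1))
    have h2 := h.Wtilde_mul_eq hy0
    have h3 := Wtilde_sub_param (ρ := ρ) (a := a) (α := α) (lam := lam) w (w1 ρ a b α lam y)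
      (b * y)
    have h4 : 0 ≤ Real.exp (ρ / a * (b * y - 1)) * (w - w1 ρ a b α lam y) :=
      mul_nonneg (Real.exp_pos _).le (sub_nonneg.2 hw)
    have hb1 : b ^ (n + 1 + 1) ≤ 1 := pow_le_one₀ h.hb0.le h.hb1.le
    have h5 : 0 ≤ ρ * (1 - b ^ (n + 1 + 1)) := mul_nonneg h.hρ.le (by linarith)
    have h6 := mul_nonneg h5 (h3 ▸ h4)
    have e3 : b ^ (n + 1 + 1) = b ^ (n + 1) * b := pow_succ _ _
    rw [e1]
    rw [e3] at h6 ⊢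
    rw [h2] at h1 h6
    linarith

/-! ### The function `W` -/

theorem mem_Ico_iff (n : ℕ) (x : ℝ) :
    x ∈ Ico (xb / b ^ (n + 1 - 1)) (xb / b ^ (n + 1)) ↔ xb ≤ b ^ n * x ∧ b ^ (n + 1) * x < xb := by
  have hb := h.hb0
  rw [mem_Ico, div_le_iff₀ (by positivity), lt_div_iff₀ (by positivity), mul_comm x, mul_comm x]
  rfl

theorem pow_mul_anti {x : ℝ} (hx : 0 < x) {m n : ℕ} (hmn : m ≤ n) : b ^ n * x ≤ b ^ m * x :=
  mul_le_mul_of_nonneg_right (pow_le_pow_of_le_one h.hb0.le h.hb1.le hmn) hx.le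

theorem exists_level {x : ℝ} (hx : 0 < x) :
    ∃ n : ℕ, b ^ n * x < xb ∧ ∀ m < n, xb ≤ b ^ m * x := by
  classical
  have hex : ∃ n : ℕ, b ^ n * x < xb := by
    obtain ⟨n, hn⟩ := exists_pow_lt_of_lt_one (div_pos h.pos hx) h.hb1
    exact ⟨n, (lt_div_iff₀ hx).1 hn⟩
  exact ⟨Nat.find hex, Nat.find_spec hex, fun m hm => not_lt.1 (Nat.find_min hex hm)⟩

theorem thresholdImpulse_eq {n : ℕ} {x : ℝ} (h1 : xb ≤ b ^ n * x) (h2 : b ^ (n + 1) * x < xb) :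
    (thresholdImpulse b xb x : ℕ) = n + 1 := by
  have hb := h.hb0
  have hx : 0 < x := pos_of_mul_pos_right (h.pos.trans_le h1) (by positivity)
  have hex : ∃ i : ℕ+, x ∈ Ico (xb / b ^ ((i : ℕ) - 1)) (xb / b ^ (i : ℕ)) :=
    ⟨n.succPNat, (h.mem_Ico_iff n x).2 ⟨h1, h2⟩⟩
  have hsp := Classical.epsilon_spec hex
  change x ∈ Ico (xb / b ^ ((thresholdImpulse b xb x : ℕ) - 1))
    (xb / b ^ (thresholdImpulse b xb x : ℕ)) at hsp
  obtain ⟨m, hm⟩ : ∃ m : ℕ, (thresholdImpulse b xb x : ℕ) = m + 1 :=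
    ⟨_, (Nat.succ_pred_eq_of_pos (thresholdImpulse b xb x).pos).symm⟩
  rw [hm, h.mem_Ico_iff] at hsp
  rw [hm]
  rcases lt_trichotomy m n with hlt | rfl | hgt
  · exact absurd (h1.trans (h.pow_mul_anti hx hlt)) (not_le.2 hsp.2)
  · rfl
  · exact absurd (hsp.1.trans (h.pow_mul_anti hx hgt)) (not_le.2 h2)

theorem W_of_level {n : ℕ} {x : ℝ} (h1 : b ^ n * x < xb) (h2 : ∀ m < n, xb ≤ b ^ m * x) :
    W ρ a b α lam xb x = Wtilde ρ a α lam (w1 ρ a b α lam xb) (b ^ n * x) := by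
  cases n with
  | zero => rw [pow_zero, one_mul] at h1 ⊢; exact W_of_lt h1
  | succ n =>
    have h3 : xb ≤ x := by simpa using h2 0 n.succ_pos
    rw [W, if_neg (not_lt.2 h3), h.thresholdImpulse_eq (h2 n n.lt_succ_self) h1]

theorem W_mul {x : ℝ} (hx : xb ≤ x) : W ρ a b α lam xb x = W ρ a b α lam xb (b * x) := by
  obtain ⟨n, h1, h2⟩ := h.exists_level (h.pos.trans_le hx)
  cases n with
  | zero => rw [pow_zero, one_mul] at h1; exact absurd h1 (not_lt.2 hx)
  | succ n =>
    rw [h.W_of_level h1 h2, h.W_of_level (n := n) (x := b * x)]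
    · congr 1; ring
    · rwa [← mul_assoc, ← pow_succ]
    · intro m hm
      rw [← mul_assoc, ← pow_succ]
      exact h2 _ (by omega)

theorem W_thresholdImpulse {x : ℝ} (hx : xb ≤ x) :
    b * xb ≤ b ^ (thresholdImpulse b xb x : ℕ) * x ∧
    b ^ (thresholdImpulse b xb x : ℕ) * x < xb ∧
    W ρ a b α lam xb (b ^ (thresholdImpulse b xb x : ℕ) * x) = W ρ a b α lam xb x := by
  obtain ⟨n, h1, h2⟩ := h.exists_level (h.pos.trans_le hx)
  cases n with
  | zero => rw [pow_zero, one_mul] at h1; exact absurd h1 (not_lt.2 hx)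
  | succ n =>
    rw [h.thresholdImpulse_eq (h2 n n.lt_succ_self) h1]
    refine ⟨?_, h1, ?_⟩
    · rw [pow_succ', mul_assoc]
      exact mul_le_mul_of_nonneg_left (h2 n n.lt_succ_self) h.hb0.le
    · rw [W_of_lt h1, h.W_of_level h1 h2]

theorem W_mul_le {x : ℝ} (hx : 0 < x) : W ρ a b α lam xb (b * x) ≤ W ρ a b α lam xb x := by
  rcases lt_or_ge x xb with hlt | hge
  · rw [W_of_lt hlt, W_of_lt ((h.mul_lt hx).trans hlt)]
    exact h.Wtilde_mul_le hx
  · exact (h.W_mul hge).ge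

theorem W_pow_mul_le (n : ℕ) {x : ℝ} (hx : 0 < x) :
    W ρ a b α lam xb (b ^ n * x) ≤ W ρ a b α lam xb x := by
  have hb := h.hb0
  induction n with
  | zero => simp
  | succ n ih =>
    rw [pow_succ', mul_assoc]
    exact (h.W_mul_le (by positivity)).trans ih

theorem W_eq_Wtilde_of_le {x : ℝ} (hx : x ≤ xb) :
    W ρ a b α lam xb x = Wtilde ρ a α lam (w1 ρ a b α lam xb) x := by
  rcases hx.lt_or_eq with hlt | rfl
  · exact W_of_lt hlt
  · rw [h.W_mul le_rfl, W_of_lt (h.mul_lt h.pos), h.Wtilde_mul_eq h.pos]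

/-- Smooth fit: the two one-sided slopes of `W` at `xb` agree. -/
theorem W_hasDerivAt_threshold :
    HasDerivAt (W ρ a b α lam xb)
      ((ρ * Wtilde ρ a α lam (w1 ρ a b α lam xb) xb - rewardRate α lam xb) / a) xb := by
  have hbx := mul_pos h.hb0 h.pos
  have hb : HasDerivAt (fun x : ℝ => b * x) b xb := by
    simpa using (hasDerivAt_id xb).const_mul b
  have hl := (Wtilde_hasDerivAt (lam := lam) h.hρ h.ha h.hα (w1 ρ a b α lam xb)
    h.pos).hasDerivWithinAt (s := Iic xb)
  have hr := ((Wtilde_hasDerivAt (lam := lam) h.hρ h.ha h.hα (w1 ρ a b α lam xb)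
    hbx).comp xb hb).hasDerivWithinAt (s := Ici xb)
  have hl' := hl.congr_of_eventuallyEq (f₁ := W ρ a b α lam xb)
    (by filter_upwards [self_mem_nhdsWithin] with x hx using h.W_eq_Wtilde_of_le hx)
    (h.W_eq_Wtilde_of_le le_rfl)
  have hr' := hr.congr_of_eventuallyEq (f₁ := W ρ a b α lam xb)
    (by
      have hlt : xb < xb / b := (lt_div_iff₀ h.hb0).2 (by linarith [h.mul_lt h.pos])
      filter_upwards [Ico_mem_nhdsGE hlt] with x hx
      rw [h.W_mul hx.1, W_of_lt]
      · rfl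
      · rw [mul_comm]; exact (lt_div_iff₀ h.hb0).1 hx.2)
    (by rw [h.W_mul le_rfl, W_of_lt (h.mul_lt h.pos)]; rfl)
  rw [div_mul_eq_mul_div, mul_comm _ b, h.slope_eq] at hr'
  have := hl'.union hr'
  rwa [Iic_union_Ici, hasDerivWithinAt_univ] at this

theorem W_hasDerivAt_level {n : ℕ} {x : ℝ} (hx : 0 < x) (h1 : b ^ n * x < xb)
    (h2 : ∀ m < n, xb ≤ b ^ m * x) :
    HasDerivAt (W ρ a b α lam xb)
      (b ^ n * ((ρ * Wtilde ρ a α lam (w1 ρ a b α lam xb) (b ^ n * x) -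
        rewardRate α lam (b ^ n * x)) / a)) x := by
  induction n generalizing x with
  | zero =>
    simp only [pow_zero, one_mul] at h1 ⊢
    refine (Wtilde_hasDerivAt h.hρ h.ha h.hα _ hx).congr_of_eventuallyEq ?_
    filter_upwards [isOpen_Iio.mem_nhds h1] with y hy using W_of_lt hy
  | succ n ih =>
    have hge : xb ≤ x := by simpa using h2 0 n.succ_pos
    rcases hge.eq_or_lt with heq | hlt
    · subst heq
      have hn : n = 0 := by
        by_contra hn
        have := h2 1 (by omega)
        rw [pow_one] at this
        exact absurd (h.mul_lt h.pos) (not_lt.2 this)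
      subst hn
      refine h.W_hasDerivAt_threshold.congr_deriv ?_
      rw [zero_add, pow_one, ← h.slope_eq]
      ring
    · have hb : HasDerivAt (fun x : ℝ => b * x) b x := by
        simpa using (hasDerivAt_id x).const_mul b
      have hbx := mul_pos h.hb0 hx
      have := ih (x := b * x) hbx (by rwa [← mul_assoc, ← pow_succ]) (fun m hm => by
        rw [← mul_assoc, ← pow_succ]
        exact h2 _ (by omega))
      have h3 := (this.comp x hb).congr_of_eventuallyEq (f₁ := W ρ a b α lam xb) (by
        filter_upwards [isOpen_Ioi.mem_nhds hlt] with y hy using h.W_mul (le_of_lt hy))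
      refine h3.congr_deriv ?_
      rw [← mul_assoc (b ^ n) b x, ← pow_succ]
      ring

theorem W_differentiableAt {x : ℝ} (hx : 0 < x) : DifferentiableAt ℝ (W ρ a b α lam xb) x := by
  obtain ⟨n, h1, h2⟩ := h.exists_level hx
  exact (h.W_hasDerivAt_level hx h1 h2).differentiableAt

theorem flow_nonpos {x : ℝ} (hx : 0 < x) :
    rewardRate α lam x - ρ * W ρ a b α lam xb x + a * deriv (W ρ a b α lam xb) x ≤ 0 := by
  obtain ⟨n, h1, h2⟩ := h.exists_level hx
  have ha := h.ha.ne'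
  rw [(h.W_hasDerivAt_level hx h1 h2).deriv, h.W_of_level h1 h2]
  cases n with
  | zero =>
    simp only [pow_zero, one_mul]
    field_simp
    linarith
  | succ n =>
    have h3 := h2 n n.lt_succ_self
    refine le_of_eq_of_le ?_ (h.flow_nonpos_of_w1_le n hx h3
      (h.w1_le (h.pos.trans_le h3)))
    field_simp

theorem flow_eq_zero {x : ℝ} (hx : 0 < x) (hxb : x ≤ xb) :
    rewardRate α lam x - ρ * W ρ a b α lam xb x + a * deriv (W ρ a b α lam xb) x = 0 := by
  have ha := h.ha.ne'
  rw [h.W_eq_Wtilde_of_le hxb]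
  have : deriv (W ρ a b α lam xb) x =
      (ρ * Wtilde ρ a α lam (w1 ρ a b α lam xb) x - rewardRate α lam x) / a := by
    rcases hxb.lt_or_eq with hlt | rfl
    · have := h.W_hasDerivAt_level (n := 0) hx (by simpa using hlt) (by simp)
      simpa using this.deriv
    · exact h.W_hasDerivAt_threshold.deriv
  rw [this]
  field_simp
  ring

theorem Wtilde_bounded (w : ℝ) :
    ∃ C, ∀ x, 0 < x → x ≤ xb → |Wtilde ρ a α lam w x| ≤ C := by
  have hr : 0 < ρ / a := div_pos h.hρ h.ha
  have ha := h.ha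
  have hα1 : 0 < α - 1 := by linarith [h.hα]
  have hα2 : 0 < 2 - α := by linarith [h.hα2]
  set Y : ℝ → ℝ := fun x => Real.exp (-(ρ / a * x)) * Wtilde ρ a α lam w x with hY
  have hYd : ∀ x, 0 < x → HasDerivAt Y (-(Real.exp (-(ρ / a * x)) * rewardRate α lam x / a)) x :=
    fun x hx => exp_neg_mul_Wtilde_hasDerivAt h.hρ h.ha h.hα w hx
  -- an antiderivative of `-c / a` which is bounded near `0`, because `α < 2`
  set G : ℝ → ℝ := fun x => (x ^ (2 - α) / ((α - 1) * (2 - α)) + lam * x ^ 2 / 2) / a with hG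
  have hGd : ∀ x, 0 < x → HasDerivAt G (-(rewardRate α lam x / a)) x := fun x hx => by
    have h1 := Real.hasDerivAt_rpow_const (p := 2 - α) (Or.inl hx.ne')
    have h2 := (((hasDerivAt_id x).pow 2).const_mul lam).div_const 2
    refine (((h1.div_const ((α - 1) * (2 - α))).add h2).div_const a).congr_deriv ?_
    have e1 : x ^ (2 - α - 1) = x ^ (1 - α) := by congr 1; ring
    have e3 : x ^ (1 - α) / (1 - α) = - (x ^ (1 - α) / (α - 1)) := by
      rw [← neg_sub α 1, div_neg]
    unfold rewardRate
    rw [e1, e3]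
    simp only [id]
    field_simp
    ring
  have hYm : MonotoneOn Y (Ioc 0 xb) := by
    refine monotoneOn_of_deriv_nonneg (convex_Ioc _ _)
      (fun x hx => (hYd x hx.1).continuousAt.continuousWithinAt) (fun x hx => ?_) fun x hx => ?_
    all_goals rw [interior_Ioc] at hx
    · exact (hYd x hx.1).differentiableAt.differentiableWithinAt
    · rw [(hYd x hx.1).deriv, neg_nonneg]
      exact div_nonpos_of_nonpos_of_nonneg (mul_nonpos_of_nonneg_of_nonpos (Real.exp_pos _).le
        (rewardRate_nonpos h.hα h.hlam hx.1)) ha.le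
  have hYG : AntitoneOn (Y - G) (Ioc 0 xb) := by
    refine antitoneOn_of_deriv_nonpos (convex_Ioc _ _)
      (fun x hx => ((hYd x hx.1).sub (hGd x hx.1)).continuousAt.continuousWithinAt)
      (fun x hx => ?_) fun x hx => ?_
    all_goals rw [interior_Ioc] at hx
    · exact ((hYd x hx.1).sub (hGd x hx.1)).differentiableAt.differentiableWithinAt
    · rw [((hYd x hx.1).sub (hGd x hx.1)).deriv]
      have h1 : Real.exp (-(ρ / a * x)) ≤ 1 := by
        apply Real.exp_le_one_iff.2
        have := mul_pos hr hx.1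
        linarith
      have h2 := rewardRate_nonpos h.hα h.hlam hx.1
      have h3 : -(Real.exp (-(ρ / a * x)) * rewardRate α lam x / a) - -(rewardRate α lam x / a) =
        (1 - Real.exp (-(ρ / a * x))) * rewardRate α lam x / a := by ring
      rw [h3]
      exact div_nonpos_of_nonpos_of_nonneg
        (mul_nonpos_of_nonneg_of_nonpos (by linarith) h2) ha.le
  refine ⟨Real.exp (ρ / a * xb) * (|Y xb| + |G xb|), fun x hx hxb => ?_⟩
  have hmem : xb ∈ Ioc 0 xb := ⟨h.pos, le_rfl⟩
  have h1 := hYm ⟨hx, hxb⟩ hmem hxb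
  have h2 := hYG ⟨hx, hxb⟩ hmem hxb
  have h3 : 0 ≤ G x := by
    have := h.hlam
    simp only [hG]
    positivity
  have h4 : |Y x| ≤ |Y xb| + |G xb| := by
    have := neg_abs_le (Y xb)
    have := le_abs_self (Y xb)
    have := le_abs_self (G xb)
    have := abs_nonneg (G xb)
    simp only [Pi.sub_apply] at h2
    rw [abs_le]
    constructor <;> linarith
  have e : Wtilde ρ a α lam w x = Real.exp (ρ / a * x) * Y x := by
    simp only [hY]
    rw [← mul_assoc, ← Real.exp_add, add_neg_cancel, Real.exp_zero, one_mul]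
  rw [e, abs_mul, abs_of_pos (Real.exp_pos _)]
  gcongr

theorem W_bounded : ∃ C, ∀ x, 0 < x → |W ρ a b α lam xb x| ≤ C := by
  obtain ⟨C, hC⟩ := h.Wtilde_bounded (w1 ρ a b α lam xb)
  refine ⟨C, fun x hx => ?_⟩
  obtain ⟨n, h1, h2⟩ := h.exists_level hx
  rw [h.W_of_level h1 h2]
  exact hC _ (mul_pos (pow_pos h.hb0 n) hx) h1.le

theorem W_lipschitz {y : ℝ} (hy : 0 < y) :
    ∃ C, 0 ≤ C ∧ ∀ p q, y ≤ p → y ≤ q →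
      |W ρ a b α lam xb q - W ρ a b α lam xb p| ≤ C * |q - p| := by
  have ha := h.ha
  set g : ℝ → ℝ := fun z =>
    (ρ * Wtilde ρ a α lam (w1 ρ a b α lam xb) z - rewardRate α lam z) / a with hg
  have hz0 : 0 < min y (b * xb) := lt_min hy (mul_pos h.hb0 h.pos)
  have hgc : ContinuousOn g (Icc (min y (b * xb)) xb) := fun z hz => by
    have hz' := hz0.trans_le hz.1
    have h1 := (Wtilde_hasDerivAt (lam := lam) h.hρ h.ha h.hα (w1 ρ a b α lam xb)
      hz').continuousAt
    have h2 := (rewardRate_hasDerivAt (lam := lam) h.hα hz').continuousAt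
    exact (((h1.const_mul ρ).sub h2).div_const a).continuousWithinAt
  obtain ⟨C, hC⟩ := isCompact_Icc.exists_bound_of_continuousOn hgc
  have hbound : ∀ x, y ≤ x → ‖deriv (W ρ a b α lam xb) x‖ ≤ max C 0 := fun x hx => by
    have hx0 := hy.trans_le hx
    obtain ⟨n, h1, h2⟩ := h.exists_level hx0
    have hz : min y (b * xb) ≤ b ^ n * x := by
      cases n with
      | zero => simpa using Or.inl hx
      | succ n =>
        refine (min_le_right _ _).trans ?_
        rw [pow_succ', mul_assoc]
        exact mul_le_mul_of_nonneg_left (h2 n n.lt_succ_self) h.hb0.le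
    rw [(h.W_hasDerivAt_level hx0 h1 h2).deriv, norm_mul, Real.norm_eq_abs,
      abs_of_pos (pow_pos h.hb0 n)]
    have h3 := hC _ ⟨hz, h1.le⟩
    have h4 : b ^ n ≤ 1 := pow_le_one₀ h.hb0.le h.hb1.le
    calc _ ≤ 1 * C := mul_le_mul h4 h3 (norm_nonneg _) zero_le_one
      _ ≤ max C 0 := by rw [one_mul]; exact le_max_left _ _
  refine ⟨max C 0, le_max_right _ _, fun p q hp hq => ?_⟩
  exact Convex.norm_image_sub_le_of_norm_hasDerivWithin_le (s := Ici y)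
    (fun x hx => (h.W_differentiableAt (hy.trans_le hx)).hasDerivAt.hasDerivWithinAt)
    hbound (convex_Ici y) hp hq

end IsThreshold

end AIMD

namespace AIMD

/-! ### Policies and controlled processes -/

namespace Policy

variable (π : Policy)

theorem monotone : Monotone π.T := by
  refine monotone_nat_of_le_succ fun i => ?_
  rcases Nat.eq_zero_or_pos i with rfl | hi
  · exact π.T_one
  · by_cases h : π.T i = ⊤
    · rw [h, π.T_top i h]
    · exact (π.T_lt i hi h).le

theorem T_nonneg (i : ℕ) : 0 ≤ π.T i := by
  rw [← π.T_zero]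
  exact π.monotone (Nat.zero_le i)

theorem T_eq_coe {i : ℕ} (h : π.T i ≠ ⊤) : π.T i = ((π.T i).toReal : EReal) :=
  (EReal.coe_toReal h (ne_bot_of_le_ne_bot EReal.zero_ne_bot (π.T_nonneg i))).symm

theorem exists_interval {t : ℝ} (ht : 0 ≤ t) :
    ∃ i, π.T i ≤ (t : EReal) ∧ (t : EReal) < π.T (i + 1) := by
  classical
  have hex : ∃ n, (t : EReal) < π.T n :=
    (EReal.tendsto_nhds_top_iff_real.1 π.T_tendsto t).exists
  have h0 : Nat.find hex ≠ 0 := fun h => by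
    have := Nat.find_spec hex
    rw [h, π.T_zero] at this
    exact absurd (EReal.coe_nonneg.2 ht) (not_le.2 this)
  obtain ⟨i, hi⟩ := Nat.exists_eq_succ_of_ne_zero h0
  refine ⟨i, not_lt.1 (Nat.find_min hex (by omega)), ?_⟩
  have := Nat.find_spec hex
  rwa [hi] at this

theorem T_ne_of_between {i : ℕ} {s : EReal} (h1 : π.T i < s) (h2 : s < π.T (i + 1)) (j : ℕ) :
    π.T j ≠ s := by
  rcases Nat.lt_or_ge i j with hj | hj
  · exact (h2.trans_le (π.monotone hj)).ne'
  · exact ((π.monotone hj).trans_lt h1).ne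

theorem eq_zero_of_T_eq_succ {i : ℕ} {t : ℝ} (h1 : π.T i = t) (h2 : π.T (i + 1) = t) : i = 0 := by
  by_contra hi
  have := π.T_lt i (Nat.pos_of_ne_zero hi) (by rw [h1]; exact EReal.coe_ne_top t)
  rw [h1, h2] at this
  exact lt_irrefl _ this

end Policy

namespace IsProcess

variable {a b x₀ : ℝ} {π : Policy} {x : ℝ → ℝ} (hx : IsProcess a b x₀ π x)

include hx

theorem hasDerivAt_of_between {i : ℕ} {τ s : ℝ} (hτ : π.T i = τ) (h1 : τ < s)
    (h2 : (s : EReal) < π.T (i + 1)) : HasDerivAt x a s := by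
  have h0 : 0 ≤ τ := by
    have := π.T_nonneg i
    rw [hτ] at this
    exact EReal.coe_nonneg.1 this
  refine hx.flow s (h0.trans_lt h1) fun j _ => π.T_ne_of_between (i := i) ?_ h2 j
  rw [hτ]
  exact EReal.coe_lt_coe_iff.2 h1

theorem eq_affine {i : ℕ} {τ t : ℝ} (hτ : π.T i = τ) (h1 : τ ≤ t)
    (h2 : (t : EReal) < π.T (i + 1)) : x t = x τ + a * (t - τ) := by
  rcases h1.eq_or_lt with rfl | hlt
  · simp
  have h0 : 0 ≤ τ := by
    have := π.T_nonneg i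
    rw [hτ] at this
    exact EReal.coe_nonneg.1 this
  have hd : ∀ s, τ < s → s ≤ t → HasDerivAt x a s := fun s hs1 hs2 =>
    hx.hasDerivAt_of_between hτ hs1 ((EReal.coe_le_coe_iff.2 hs2).trans_lt h2)
  have hc : ContinuousOn x (Icc τ t) := fun s hs => by
    rcases hs.1.eq_or_lt with rfl | hs1
    · exact (hx.right_cont τ h0).mono Icc_subset_Ici_self
    · exact (hd s hs1 hs.2).continuousAt.continuousWithinAt
  obtain ⟨c, -, hc'⟩ := exists_hasDerivAt_eq_slope x (fun _ => a) hlt hc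
    fun s hs => hd s hs.1 hs.2.le
  have : t - τ ≠ 0 := by linarith
  field_simp at hc'
  linarith

theorem leftLim_eq_affine {i : ℕ} {τ t : ℝ} (hτ : π.T i = τ) (h1 : τ < t)
    (h2 : π.T (i + 1) = t) : Function.leftLim x t = x τ + a * (t - τ) := by
  refine leftLim_eq_of_tendsto ?_
  have hc : Tendsto (fun s => x τ + a * (s - τ)) (𝓝[<] t) (𝓝 (x τ + a * (t - τ))) :=
    (Continuous.tendsto (by fun_prop) t).mono_left nhdsWithin_le_nhds
  refine hc.congr' ?_
  filter_upwards [Ioo_mem_nhdsLT h1] with s hs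
  refine (hx.eq_affine hτ hs.1.le ?_).symm
  rw [h2]
  exact EReal.coe_lt_coe_iff.2 hs.2

theorem leftLim_zero : Function.leftLim x 0 = x₀ := by
  refine leftLim_eq_of_tendsto ?_
  refine tendsto_const_nhds.congr' ?_
  filter_upwards [self_mem_nhdsWithin] with s hs using (hx.before s hs).symm

theorem pos_at (hb0 : 0 < b) (ha : 0 < a) (hx₀ : 0 < x₀) (i : ℕ) {τ : ℝ} (hτ : π.T i = τ) :
    0 < x τ := by
  have hz : 0 < x 0 := by
    by_cases h : π.T 1 = 0
    · rw [hx.jump 1 0 le_rfl h, hx.leftLim_zero]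
      positivity
    · rwa [hx.start h]
  induction i generalizing τ with
  | zero =>
    rw [π.T_zero] at hτ
    have : τ = 0 := (EReal.coe_eq_zero.1 hτ.symm)
    rwa [this]
  | succ i ih =>
    have hne : π.T i ≠ ⊤ := fun h => by
      rw [π.T_top i h] at hτ
      exact EReal.coe_ne_top τ hτ.symm
    have hi := π.T_eq_coe hne
    have hle : (π.T i).toReal ≤ τ := by
      have := π.monotone (Nat.le_succ i)
      rw [hi, hτ] at this
      exact EReal.coe_le_coe_iff.1 this
    rcases hle.eq_or_lt with heq | hlt
    · rw [← heq]; exact ih hi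
    · rw [hx.jump (i + 1) τ (by omega) hτ, hx.leftLim_eq_affine hi hlt hτ]
      have := ih hi
      have : 0 < τ - (π.T i).toReal := by linarith
      positivity

theorem pos (hb0 : 0 < b) (ha : 0 < a) (hx₀ : 0 < x₀) {t : ℝ} (ht : 0 ≤ t) : 0 < x t := by
  obtain ⟨i, h1, h2⟩ := π.exists_interval ht
  have hi := π.T_eq_coe (ne_top_of_le_ne_top (EReal.coe_ne_top t) h1)
  have h3 : (π.T i).toReal ≤ t := by
    rw [hi] at h1
    exact EReal.coe_le_coe_iff.1 h1
  rw [hx.eq_affine hi h3 h2]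
  have := hx.pos_at hb0 ha hx₀ i hi
  have : 0 ≤ t - (π.T i).toReal := by linarith
  positivity

/-- Summation of the discounted reward over the intervals between impulses: if a function `V` does
not increase at the impulses and dominates the running reward `g` on each interval, then it
dominates the total. It is used with `(V, g) = (W, c)` for an upper bound on the reward and with
`(V, g) = (-W, -c)` for a lower bound. -/
theorem integral_le {ρ : ℝ} (hb0 : 0 < b) (ha : 0 < a) (hx₀ : 0 < x₀) {V g : ℝ → ℝ}
    (hg : ContinuousOn g (Ioi 0))
    (hjump : ∀ (i : ℕ) (t : ℝ), 1 ≤ i → π.T i = t → V (x t) ≤ V (Function.leftLim x t))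
    (hseg : ∀ (i : ℕ) (τ t : ℝ), π.T i = τ → τ < t → (t : EReal) ≤ π.T (i + 1) →
      ∫ s in τ..t, Real.exp (-ρ * s) * g (x τ + a * (s - τ)) ≤
        Real.exp (-ρ * τ) * V (x τ) - Real.exp (-ρ * t) * V (x τ + a * (t - τ)))
    {t : ℝ} (ht : 0 ≤ t) :
    ∫ s in (0 : ℝ)..t, Real.exp (-ρ * s) * g (x s) ≤ V x₀ - Real.exp (-ρ * t) * V (x t) := by
  set f : ℝ → ℝ := fun s => Real.exp (-ρ * s) * g (x s) with hf
  have hcongr : ∀ (i : ℕ) (τ t : ℝ), π.T i = τ → τ < t → (t : EReal) ≤ π.T (i + 1) →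
      IntervalIntegrable f volume τ t ∧
      ∫ s in τ..t, f s ≤
        Real.exp (-ρ * τ) * V (x τ) - Real.exp (-ρ * t) * V (x τ + a * (t - τ)) := by
    intro i τ t hτ h1 h2
    have hpos := hx.pos_at hb0 ha hx₀ i hτ
    have hae : ∀ᵐ s ∂volume.restrict (uIoc τ t),
        Real.exp (-ρ * s) * g (x τ + a * (s - τ)) = f s := by
      rw [uIoc_of_le h1.le, ← restrict_Ioo_eq_restrict_Ioc]
      refine (ae_restrict_mem measurableSet_Ioo).mono fun s hs => ?_
      have := hx.eq_affine hτ hs.1.le ((EReal.coe_lt_coe_iff.2 hs.2).trans_le h2)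
      simp only [hf, this]
    have hint : IntervalIntegrable (fun s => Real.exp (-ρ * s) * g (x τ + a * (s - τ)))
        volume τ t := by
      refine ContinuousOn.intervalIntegrable (ContinuousOn.mul (by fun_prop)
        (hg.comp (by fun_prop) fun s hs => ?_))
      rw [uIcc_of_le h1.le] at hs
      have : 0 ≤ s - τ := by linarith [hs.1]
      simp only [mem_Ioi]
      positivity
    refine ⟨hint.congr_ae hae, ?_⟩
    rw [← intervalIntegral.integral_congr_ae_restrict hae]
    exact hseg i τ t hτ h1 h2
  have hz : V (x 0) ≤ V x₀ := by
    by_cases h : π.T 1 = 0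
    · simpa [hx.leftLim_zero] using hjump 1 0 le_rfl h
    · rw [hx.start h]
  have hind : ∀ (i : ℕ) (τ : ℝ), π.T i = τ → IntervalIntegrable f volume 0 τ ∧
      ∫ s in (0 : ℝ)..τ, f s ≤ V x₀ - Real.exp (-ρ * τ) * V (x τ) := by
    intro i
    induction i with
    | zero =>
      intro τ hτ
      rw [π.T_zero] at hτ
      have : τ = 0 := (EReal.coe_eq_zero.1 hτ.symm)
      subst this
      simpa using hz
    | succ i ih =>
      intro t hτ
      have hne : π.T i ≠ ⊤ := fun h => by
        rw [π.T_top i h] at hτ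
        exact EReal.coe_ne_top t hτ.symm
      have hi := π.T_eq_coe hne
      have hle : (π.T i).toReal ≤ t := by
        have := π.monotone (Nat.le_succ i)
        rw [hi, hτ] at this
        exact EReal.coe_le_coe_iff.1 this
      rcases hle.eq_or_lt with heq | hlt
      · rw [← heq]; exact ih _ hi
      · obtain ⟨h1, h2⟩ := ih _ hi
        obtain ⟨h3, h4⟩ := hcongr i _ t hi hlt hτ.ge
        refine ⟨h1.trans h3, ?_⟩
        rw [← intervalIntegral.integral_add_adjacent_intervals h1 h3]
        have h5 := hjump (i + 1) t (by omega) hτ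
        rw [hx.leftLim_eq_affine hi hlt hτ] at h5
        have h6 := mul_le_mul_of_nonneg_left h5 (Real.exp_pos (-ρ * t)).le
        linarith
  obtain ⟨i, h1, h2⟩ := π.exists_interval ht
  have hi := π.T_eq_coe (ne_top_of_le_ne_top (EReal.coe_ne_top t) h1)
  have h3 : (π.T i).toReal ≤ t := by
    rw [hi] at h1
    exact EReal.coe_le_coe_iff.1 h1
  rcases h3.eq_or_lt with heq | hlt
  · exact (hind i t (by rw [hi, heq])).2
  · obtain ⟨h4, h5⟩ := hind i _ hi
    obtain ⟨h6, h7⟩ := hcongr i _ t hi hlt h2.le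
    rw [← intervalIntegral.integral_add_adjacent_intervals h4 h6, hx.eq_affine hi hlt.le h2]
    linarith

end IsProcess

theorem absContOn_of_lipschitz {g : ℝ → ℝ} {s : Set ℝ} {K : ℝ} (hK : 0 ≤ K)
    (h : ∀ p ∈ s, ∀ q ∈ s, p ≤ q → |g q - g p| ≤ K * (q - p)) : AbsContOn g s := by
  intro ε hε
  refine ⟨ε / (K + 1), by positivity, fun n p q hpq _ hsum => ?_⟩
  have h1 : ∑ k, |g (q k) - g (p k)| ≤ K * ∑ k, (q k - p k) := by
    rw [Finset.mul_sum]
    refine Finset.sum_le_sum fun k _ => ?_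
    obtain ⟨hle, hsub⟩ := hpq k
    exact h _ (hsub (left_mem_Icc.2 hle)) _ (hsub (right_mem_Icc.2 hle)) hle
  have h0 : 0 ≤ ∑ k, (q k - p k) := Finset.sum_nonneg fun k _ => sub_nonneg.2 (hpq k).1
  rw [lt_div_iff₀ (by positivity)] at hsum
  nlinarith

theorem integral_segment_le {ρ a τ t y : ℝ} (ha : 0 < a) (hy : 0 < y) (hτ : τ ≤ t) {V g : ℝ → ℝ}
    (hg : ContinuousOn g (Ioi 0)) (hV : ∀ z, 0 < z → DifferentiableAt ℝ V z)
    (hle : ∀ z, y ≤ z → z ≤ y + a * (t - τ) → g z - ρ * V z + a * deriv V z ≤ 0) :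
    ∫ s in τ..t, Real.exp (-ρ * s) * g (y + a * (s - τ)) ≤
      Real.exp (-ρ * τ) * V y - Real.exp (-ρ * t) * V (y + a * (t - τ)) := by
  have hp : ∀ s, τ ≤ s → y ≤ y + a * (s - τ) := fun s hs => by
    have : 0 ≤ a * (s - τ) := mul_nonneg ha.le (by linarith)
    linarith
  have hd : ∀ s, τ ≤ s → HasDerivAt (fun s => -(Real.exp (-ρ * s) * V (y + a * (s - τ))))
      (-(Real.exp (-ρ * s) * (-ρ) * V (y + a * (s - τ)) +
        Real.exp (-ρ * s) * (deriv V (y + a * (s - τ)) * a))) s := fun s hs => by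
    have h1 : HasDerivAt (fun s : ℝ => Real.exp (-ρ * s)) (Real.exp (-ρ * s) * (-ρ)) s := by
      simpa using ((hasDerivAt_id s).const_mul (-ρ)).exp
    have h2 : HasDerivAt (fun s : ℝ => y + a * (s - τ)) a s := by
      simpa using (((hasDerivAt_id s).sub_const τ).const_mul a).const_add y
    have h3 := (hV _ (hy.trans_le (hp s hs))).hasDerivAt.comp s h2
    exact (h1.mul h3).neg
  have := intervalIntegral.integral_le_sub_of_hasDeriv_right_of_le hτ
    (fun s hs => (hd s hs.1).continuousAt.continuousWithinAt)
    (fun s hs => (hd s hs.1.le).hasDerivWithinAt)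
    (φ := fun s => Real.exp (-ρ * s) * g (y + a * (s - τ)))
    (ContinuousOn.integrableOn_Icc (ContinuousOn.mul (by fun_prop)
      (hg.comp (by fun_prop) fun s hs => hy.trans_le (hp s hs.1))))
    (fun s hs => by
      have h1 := hle _ (hp s hs.1.le) (by have := hs.2.le; gcongr)
      have h2 := mul_le_mul_of_nonneg_left h1 (Real.exp_pos (-ρ * s)).le
      linarith)
  simp only [sub_self, mul_zero, add_zero] at this
  linarith

namespace IsThreshold

variable {ρ a b α lam xb : ℝ} (h : IsThreshold ρ a b α lam xb)

include h

theorem absContOn_W {x₀ : ℝ} {π : Policy} {x : ℝ → ℝ} (hx₀ : 0 < x₀)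
    (hx : IsProcess a b x₀ π x) (i : ℕ) :
    AbsContOn (fun t => W ρ a b α lam xb (x t))
      {t : ℝ | π.T i ≤ (t : EReal) ∧ (t : EReal) < π.T (i + 1)} := by
  by_cases htop : π.T i = ⊤
  · refine absContOn_of_lipschitz le_rfl fun p hp => ?_
    have := hp.1
    rw [htop, top_le_iff] at this
    exact absurd this (EReal.coe_ne_top p)
  have hi := π.T_eq_coe htop
  set τ := (π.T i).toReal with hτ
  have ha := h.ha
  have hy := hx.pos_at h.hb0 h.ha hx₀ i hi
  obtain ⟨C, hC, hlip⟩ := h.W_lipschitz hy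
  have haff : ∀ t ∈ {t : ℝ | π.T i ≤ (t : EReal) ∧ (t : EReal) < π.T (i + 1)},
      τ ≤ t ∧ x t = x τ + a * (t - τ) := fun t ht => by
    have h1 : τ ≤ t := by
      have := ht.1
      rw [hi] at this
      exact EReal.coe_le_coe_iff.1 this
    exact ⟨h1, hx.eq_affine hi h1 ht.2⟩
  refine absContOn_of_lipschitz (mul_nonneg hC h.ha.le) fun p hp q hq hpq => ?_
  obtain ⟨hp1, hp2⟩ := haff p hp
  obtain ⟨hq1, hq2⟩ := haff q hq
  have h1 : 0 ≤ a * (p - τ) := mul_nonneg ha.le (by linarith)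
  have h2 : 0 ≤ a * (q - τ) := mul_nonneg ha.le (by linarith)
  refine (hlip (x p) (x q) (by linarith) (by linarith)).trans_eq ?_
  have h3 : x q - x p = a * (q - p) := by rw [hp2, hq2]; ring
  rw [h3, abs_of_nonneg (mul_nonneg ha.le (by linarith)), mul_assoc]

theorem rewardRate_continuousOn : ContinuousOn (rewardRate α lam) (Ioi 0) := fun _ hx =>
  (rewardRate_hasDerivAt h.hα hx).continuousAt.continuousWithinAt

theorem reward_le_W {x₀ : ℝ} {π : Policy} {x : ℝ → ℝ} (hx₀ : 0 < x₀)
    (hx : IsProcess a b x₀ π x) {t : ℝ} (ht : 0 ≤ t) :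
    ∫ s in (0 : ℝ)..t, Real.exp (-ρ * s) * rewardRate α lam (x s) ≤
      W ρ a b α lam xb x₀ - Real.exp (-ρ * t) * W ρ a b α lam xb (x t) := by
  refine hx.integral_le h.hb0 h.ha hx₀ h.rewardRate_continuousOn (fun i t hi hT => ?_)
    (fun i τ t hT hτt hle => ?_) ht
  · have hpos : 0 < Function.leftLim x t := by
      have h1 : 0 ≤ t := by
        have := π.T_nonneg i
        rw [hT] at this
        exact EReal.coe_nonneg.1 this
      have h2 := hx.pos h.hb0 h.ha hx₀ h1
      rw [hx.jump i t hi hT] at h2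
      exact pos_of_mul_pos_right h2 (pow_pos h.hb0 _).le
    rw [hx.jump i t hi hT]
    exact h.W_pow_mul_le _ hpos
  · have hy := hx.pos_at h.hb0 h.ha hx₀ i hT
    exact integral_segment_le h.ha hy hτt.le h.rewardRate_continuousOn
      (fun z hz => h.W_differentiableAt hz) fun z hz _ => h.flow_nonpos (hy.trans_le hz)

theorem tendsto_exp_mul_W {x₀ : ℝ} {π : Policy} {x : ℝ → ℝ} (hx₀ : 0 < x₀)
    (hx : IsProcess a b x₀ π x) :
    Tendsto (fun t : ℝ => ((W ρ a b α lam xb x₀ -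
      Real.exp (-ρ * t) * W ρ a b α lam xb (x t) : ℝ) : EReal)) atTop
      (𝓝 (W ρ a b α lam xb x₀ : EReal)) := by
  obtain ⟨C, hC⟩ := h.W_bounded
  refine EReal.tendsto_coe.2 ?_
  have h1 : Tendsto (fun t : ℝ => Real.exp (-ρ * t) * W ρ a b α lam xb (x t)) atTop (𝓝 0) := by
    have h2 : Tendsto (fun t : ℝ => Real.exp (-ρ * t) * C) atTop (𝓝 0) := by
      have := (Real.tendsto_exp_atBot.comp
        (tendsto_id.const_mul_atTop_of_neg (neg_lt_zero.2 h.hρ))).mul_const C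
      simpa using this
    refine squeeze_zero_norm' ?_ h2
    filter_upwards [eventually_ge_atTop 0] with t ht
    rw [norm_mul, Real.norm_eq_abs, abs_of_pos (Real.exp_pos _)]
    exact mul_le_mul_of_nonneg_left (hC _ (hx.pos h.hb0 h.ha hx₀ ht)) (Real.exp_pos _).le
  simpa using h1.const_sub (W ρ a b α lam xb x₀)

theorem discountedReward_le {x₀ : ℝ} {π : Policy} {x : ℝ → ℝ} (hx₀ : 0 < x₀)
    (hx : IsProcess a b x₀ π x) :
    discountedReward ρ α lam x ≤ (W ρ a b α lam xb x₀ : EReal) := by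
  rw [← (h.tendsto_exp_mul_W hx₀ hx).liminf_eq]
  refine liminf_le_liminf ?_
  filter_upwards [eventually_ge_atTop 0] with t ht
  exact EReal.coe_le_coe_iff.2 (h.reward_le_W hx₀ hx ht)

theorem verificationConditions :
    VerificationConditions ρ a b α lam (W ρ a b α lam xb) ∅ (Ici xb) (thresholdImpulse b xb) where
  continuousOn := fun _ hx => (h.W_differentiableAt hx).continuousAt.continuousWithinAt
  exceptional_subset := empty_subset _
  differentiableAt := fun _ hx _ => h.W_differentiableAt hx
  absCont := fun _ _ _ hx₀ hx i => h.absContOn_W hx₀ hx i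
  null := fun _ _ _ _ _ => by simp
  bellman := fun x hx _ => by
    have hsup : (⨆ i : ℕ+, ((W ρ a b α lam xb (b ^ (i : ℕ) * x) -
        W ρ a b α lam xb x : ℝ) : EReal)) ≤ 0 :=
      iSup_le fun i => by exact_mod_cast sub_nonpos.2 (h.W_pow_mul_le i hx)
    rcases le_total x xb with hle | hge
    · rw [h.flow_eq_zero hx hle, EReal.coe_zero]
      exact max_eq_left hsup
    · have hge0 : (0 : EReal) ≤ ⨆ i : ℕ+, ((W ρ a b α lam xb (b ^ (i : ℕ) * x) -
          W ρ a b α lam xb x : ℝ) : EReal) := by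
        refine le_iSup_of_le (thresholdImpulse b xb x) ?_
        rw [(h.W_thresholdImpulse hge).2.2, sub_self, EReal.coe_zero]
      rw [le_antisymm hsup hge0]
      exact max_eq_right (by exact_mod_cast h.flow_nonpos hx)
  bellman_exceptional := fun _ hx => absurd hx (notMem_empty _)
  measurableSet := measurableSet_Ici
  subset := fun _ hx => h.pos.trans_le hx
  flow_eq := fun _ hx _ hL => h.flow_eq_zero hx (not_le.1 hL).le
  impulse_eq := fun _ hx => sub_eq_zero.2 (h.W_thresholdImpulse hx).2.2
  leaves := fun _ hx => ⟨mul_pos (pow_pos h.hb0 _) (h.pos.trans_le hx),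
    not_le.2 (h.W_thresholdImpulse hx).2.1⟩

end IsThreshold

end AIMD

namespace AIMD

/-! ### The threshold feedback policy -/

/-- The first time after `τ` at which the state, growing freely from `y` at time `τ`, is at least
`xb`. If `xb ≤ y` the infimum `τ` is not attained. -/
theorem sInf_hitting {a τ y xb : ℝ} (ha : 0 < a) :
    sInf ((fun t : ℝ => (t : EReal)) ''
      {t : ℝ | (τ : EReal) < (t : EReal) ∧ y + a * (t - τ) ∈ Ici xb}) =
      ((τ + max 0 ((xb - y) / a) : ℝ) : EReal) := by
  have hmem : ∀ t : ℝ, τ < t → τ + max 0 ((xb - y) / a) ≤ t →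
      t ∈ {t : ℝ | (τ : EReal) < (t : EReal) ∧ y + a * (t - τ) ∈ Ici xb} := fun t h1 h2 => by
    refine ⟨EReal.coe_lt_coe_iff.2 h1, ?_⟩
    have h3 : (xb - y) / a ≤ t - τ := by
      have := le_max_right 0 ((xb - y) / a)
      linarith
    rw [div_le_iff₀ ha] at h3
    simp only [mem_Ici]
    linarith
  refine le_antisymm ?_ ?_
  · refine EReal.le_of_forall_lt_iff_le.1 fun z hz => ?_
    have hz' := EReal.coe_lt_coe_iff.1 hz
    have h0 := le_max_left 0 ((xb - y) / a)
    exact sInf_le ⟨z, hmem z (by linarith) hz'.le, rfl⟩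
  · refine le_sInf ?_
    rintro _ ⟨t, ⟨h1, h2⟩, rfl⟩
    have h1 := EReal.coe_lt_coe_iff.1 h1
    refine EReal.coe_le_coe_iff.2 ?_
    have h3 : (xb - y) / a ≤ t - τ := by
      rw [div_le_iff₀ ha]
      simp only [mem_Ici] at h2
      linarith
    have := max_le (sub_pos.2 h1).le h3
    linarith

theorem IsProcess.postState_eq {a b x₀ : ℝ} {π : Policy} {x : ℝ → ℝ}
    (hx : IsProcess a b x₀ π x) {i : ℕ} {τ t : ℝ} (hτ : π.T i = τ) (hlt : τ < t)
    (hle : (t : EReal) ≤ π.T (i + 1)) :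
    postState x₀ π x i = x τ := by
  unfold postState
  split_ifs with hi
  · subst hi
    have h0 : τ = 0 := by
      rw [π.T_zero] at hτ
      exact EReal.coe_eq_zero.1 hτ.symm
    subst h0
    refine (hx.start fun h1 => ?_).symm
    rw [h1] at hle
    exact absurd (EReal.coe_nonpos.1 hle) (not_le.2 hlt)
  · rw [hτ, EReal.toReal_coe]

namespace IsThreshold

variable {ρ a b α lam xb : ℝ} (h : IsThreshold ρ a b α lam xb)

include h

theorem feedback_time {x₀ : ℝ} {π : Policy} {x : ℝ → ℝ}
    (hf : FollowsFeedback a x₀ (Ici xb) (thresholdImpulse b xb) π x) {i : ℕ} {τ : ℝ}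
    (hτ : π.T i = τ) :
    π.T (i + 1) = ((τ + max 0 ((xb - postState x₀ π x i) / a) : ℝ) : EReal) := by
  rw [hf.time i, hτ, EReal.toReal_coe]
  exact sInf_hitting h.ha

theorem leftLim_mem_of_feedback {x₀ : ℝ} {π : Policy} {x : ℝ → ℝ} (hx : IsProcess a b x₀ π x)
    (hf : FollowsFeedback a x₀ (Ici xb) (thresholdImpulse b xb) π x) {i : ℕ} {t : ℝ} (hi : 1 ≤ i)
    (hT : π.T i = t) : xb ≤ Function.leftLim x t := by
  obtain ⟨j, rfl⟩ := Nat.exists_eq_add_of_le' hi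
  have ha := h.ha
  have hne : π.T j ≠ ⊤ := fun htop => by
    rw [π.T_top j htop] at hT
    exact EReal.coe_ne_top t hT.symm
  have hj := π.T_eq_coe hne
  set τ := (π.T j).toReal
  have ht := h.feedback_time hf hj
  rw [hT, EReal.coe_eq_coe_iff] at ht
  have h1 := le_max_left 0 ((xb - postState x₀ π x j) / a)
  have h2 := le_max_right 0 ((xb - postState x₀ π x j) / a)
  rcases (by linarith : τ ≤ t).eq_or_lt with heq | hlt
  · rw [← heq] at hT
    have hj0 := π.eq_zero_of_T_eq_succ hj hT
    subst hj0
    rw [π.T_zero] at hj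
    have h0 : τ = 0 := EReal.coe_eq_zero.1 hj.symm
    rw [← heq, h0, hx.leftLim_zero]
    have h3 : (xb - x₀) / a ≤ 0 := by
      have : postState x₀ π x 0 = x₀ := if_pos rfl
      rw [this] at h2 ht
      linarith
    rw [div_le_iff₀ ha] at h3
    linarith
  · rw [hx.postState_eq hj hlt hT.ge] at h2 ht
    rw [hx.leftLim_eq_affine hj hlt hT]
    have h3 : (xb - x τ) / a ≤ t - τ := by linarith
    rw [div_le_iff₀ ha] at h3
    linarith

theorem discountedReward_eq_of_feedback {x₀ : ℝ} {π : Policy} {x : ℝ → ℝ} (hx₀ : 0 < x₀)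
    (hx : IsProcess a b x₀ π x)
    (hf : FollowsFeedback a x₀ (Ici xb) (thresholdImpulse b xb) π x) :
    discountedReward ρ α lam x = (W ρ a b α lam xb x₀ : EReal) := by
  have ha := h.ha
  rw [← (h.tendsto_exp_mul_W hx₀ hx).liminf_eq]
  refine liminf_congr ?_
  filter_upwards [eventually_ge_atTop 0] with t ht
  refine EReal.coe_eq_coe_iff.2 (le_antisymm (h.reward_le_W hx₀ hx ht) ?_)
  have hneg := hx.integral_le (ρ := ρ) h.hb0 h.ha hx₀ (V := fun z => -W ρ a b α lam xb z)
    (g := fun z => -rewardRate α lam z) h.rewardRate_continuousOn.neg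
    (fun i t hi hT => ?_) (fun i τ t hT hτt hle => ?_) ht
  · simp only [mul_neg, intervalIntegral.integral_neg] at hneg
    linarith
  · rw [hx.jump i t hi hT, hf.action i t hi hT]
    exact (neg_le_neg (h.W_thresholdImpulse (h.leftLim_mem_of_feedback hx hf hi hT)).2.2.ge)
  · have hy := hx.pos_at h.hb0 h.ha hx₀ i hT
    refine integral_segment_le h.ha hy hτt.le h.rewardRate_continuousOn.neg
      (fun z hz => (h.W_differentiableAt hz).neg) fun z hz hz' => ?_
    have hzb : z ≤ xb := by
      have h1 := hle
      rw [h.feedback_time hf hT, hx.postState_eq hT hτt hle, EReal.coe_le_coe_iff] at h1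
      have h2 : (xb - x τ) / a = max 0 ((xb - x τ) / a) := by
        rcases max_choice 0 ((xb - x τ) / a) with h3 | h3
        · rw [h3] at h1; linarith
        · exact h3.symm
      have h3 : t - τ ≤ (xb - x τ) / a := by linarith
      rw [le_div_iff₀ ha] at h3
      linarith
    have h4 := h.flow_eq_zero (hy.trans_le hz) hzb
    rw [deriv.neg]
    simp only [Pi.neg_apply]
    linarith

end IsThreshold

/-- The successive states right after the impulses of the threshold policy. -/
noncomputable def feedbackState (b xb x₀ : ℝ) : ℕ → ℝ
  | 0 => x₀
  | n + 1 => b ^ (thresholdImpulse b xb (max xb (feedbackState b xb x₀ n)) : ℕ) *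
      max xb (feedbackState b xb x₀ n)

/-- The impulse moments of the threshold policy, starting with the convention `T 0 = 0`. -/
noncomputable def feedbackTime (a b xb x₀ : ℝ) : ℕ → ℝ
  | 0 => 0
  | n + 1 => feedbackTime a b xb x₀ n + max 0 ((xb - feedbackState b xb x₀ n) / a)

theorem feedbackTime_le_succ (a b xb x₀ : ℝ) (n : ℕ) :
    feedbackTime a b xb x₀ n ≤ feedbackTime a b xb x₀ (n + 1) := by
  rw [feedbackTime]
  linarith [le_max_left 0 ((xb - feedbackState b xb x₀ n) / a)]

theorem feedbackTime_monotone (a b xb x₀ : ℝ) : Monotone (feedbackTime a b xb x₀) :=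
  monotone_nat_of_le_succ (feedbackTime_le_succ a b xb x₀)

open Classical in
/-- The state process of the threshold policy: on the interval between the `n`-th and the
`(n + 1)`-st impulse it grows freely from `feedbackState n`. -/
noncomputable def feedbackProcess (a b xb x₀ t : ℝ) : ℝ :=
  if t < 0 then x₀
  else if ht : ∃ n, t < feedbackTime a b xb x₀ (n + 1) then
    feedbackState b xb x₀ (Nat.find ht) + a * (t - feedbackTime a b xb x₀ (Nat.find ht))
  else 0

theorem feedbackProcess_eq {a b xb x₀ : ℝ} {n : ℕ} {t : ℝ} (h1 : feedbackTime a b xb x₀ n ≤ t)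
    (h2 : t < feedbackTime a b xb x₀ (n + 1)) :
    feedbackProcess a b xb x₀ t =
      feedbackState b xb x₀ n + a * (t - feedbackTime a b xb x₀ n) := by
  classical
  have h0 : 0 ≤ t := (feedbackTime_monotone a b xb x₀ (Nat.zero_le n)).trans h1
  have hex : ∃ n, t < feedbackTime a b xb x₀ (n + 1) := ⟨n, h2⟩
  have hn : Nat.find hex = n := (Nat.find_eq_iff hex).2
    ⟨h2, fun m hm => not_lt.2 ((feedbackTime_monotone a b xb x₀ hm).trans h1)⟩
  rw [feedbackProcess, if_neg (not_lt.2 h0), dif_pos hex]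
  simp only [hn]

namespace IsThreshold

variable {ρ a b α lam xb : ℝ} (h : IsThreshold ρ a b α lam xb) (x₀ : ℝ)

include h

theorem feedbackState_succ_lt (n : ℕ) : feedbackState b xb x₀ (n + 1) < xb :=
  (h.W_thresholdImpulse (le_max_left xb (feedbackState b xb x₀ n))).2.1

theorem feedbackState_add_two (n : ℕ) :
    feedbackState b xb x₀ (n + 2) = b ^ (thresholdImpulse b xb xb : ℕ) * xb := by
  rw [feedbackState, max_eq_left (h.feedbackState_succ_lt x₀ n).le]

theorem feedbackTime_lt_succ (n : ℕ) :
    feedbackTime a b xb x₀ (n + 1) < feedbackTime a b xb x₀ (n + 2) := by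
  have h1 : 0 < (xb - feedbackState b xb x₀ (n + 1)) / a :=
    div_pos (sub_pos.2 (h.feedbackState_succ_lt x₀ n)) h.ha
  rw [feedbackTime.eq_2 _ _ _ _ (n + 1)]
  linarith [le_max_right 0 ((xb - feedbackState b xb x₀ (n + 1)) / a)]

theorem tendsto_feedbackTime : Tendsto (feedbackTime a b xb x₀) atTop atTop := by
  set d := (xb - b ^ (thresholdImpulse b xb xb : ℕ) * xb) / a with hd
  have hd0 : 0 < d := div_pos (sub_pos.2 (h.W_thresholdImpulse le_rfl).2.1) h.ha
  have hle : ∀ n : ℕ, (n : ℝ) * d ≤ feedbackTime a b xb x₀ (n + 2) := by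
    intro n
    induction n with
    | zero =>
      simpa [feedbackTime] using feedbackTime_monotone a b xb x₀ (Nat.zero_le 2)
    | succ n ih =>
      rw [show n + 1 + 2 = (n + 2) + 1 by ring, feedbackTime, h.feedbackState_add_two]
      have := le_max_right 0 d
      push_cast
      linarith
  rw [← tendsto_add_atTop_iff_nat 2]
  exact tendsto_atTop_mono hle (tendsto_natCast_atTop_atTop.atTop_mul_const hd0)

theorem exists_feedbackTime_gt (t : ℝ) : ∃ n, t < feedbackTime a b xb x₀ (n + 1) :=
  ((tendsto_add_atTop_iff_nat 1).2 (h.tendsto_feedbackTime x₀) |>.eventually_gt_atTop t).exists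

theorem exists_feedback_interval {t : ℝ} (ht : 0 ≤ t) :
    ∃ n, feedbackTime a b xb x₀ n ≤ t ∧ t < feedbackTime a b xb x₀ (n + 1) := by
  classical
  have hex := h.exists_feedbackTime_gt x₀ t
  refine ⟨Nat.find hex, ?_, Nat.find_spec hex⟩
  rcases hn : Nat.find hex with _ | m
  · exact ht
  · exact not_lt.1 (Nat.find_min hex (by omega : m < Nat.find hex))

/-- At the impulse moments the process is in its post-impulse state. -/
theorem feedbackProcess_time (n : ℕ) :
    feedbackProcess a b xb x₀ (feedbackTime a b xb x₀ (n + 1)) = feedbackState b xb x₀ (n + 1) := by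
  rw [feedbackProcess_eq le_rfl (h.feedbackTime_lt_succ x₀ n)]
  ring

theorem feedbackProcess_leftLim (n : ℕ) :
    Function.leftLim (feedbackProcess a b xb x₀) (feedbackTime a b xb x₀ (n + 1)) =
      max xb (feedbackState b xb x₀ n) := by
  have ha := h.ha
  refine leftLim_eq_of_tendsto ?_
  rcases (feedbackTime_le_succ a b xb x₀ n).eq_or_lt with heq | hlt
  · have hn : n = 0 := by
      by_contra hn
      obtain ⟨m, rfl⟩ := Nat.exists_eq_succ_of_ne_zero hn
      exact (h.feedbackTime_lt_succ x₀ m).ne heq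
    subst hn
    have h1 := le_max_right 0 ((xb - feedbackState b xb x₀ 0) / a)
    have h2 : (xb - feedbackState b xb x₀ 0) / a ≤ 0 := by
      rw [feedbackTime.eq_2] at heq
      linarith
    rw [div_le_iff₀ ha, zero_mul] at h2
    rw [max_eq_right (by linarith), ← heq]
    refine tendsto_const_nhds.congr' ?_
    filter_upwards [self_mem_nhdsWithin] with s hs
    exact (if_pos hs).symm
  · have hc : Tendsto
        (fun s => feedbackState b xb x₀ n + a * (s - feedbackTime a b xb x₀ n))
        (𝓝[<] (feedbackTime a b xb x₀ (n + 1))) (𝓝 (max xb (feedbackState b xb x₀ n))) := by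
      have h1 : feedbackState b xb x₀ n +
          a * (feedbackTime a b xb x₀ (n + 1) - feedbackTime a b xb x₀ n) =
          max xb (feedbackState b xb x₀ n) := by
        rw [feedbackTime, add_sub_cancel_left, mul_max_of_nonneg _ _ ha.le, mul_zero,
          mul_div_cancel₀ _ ha.ne', max_comm xb]
        rw [← max_add_add_left]
        simp
      rw [← h1]
      exact (Continuous.tendsto (by fun_prop) _).mono_left nhdsWithin_le_nhds
    refine hc.congr' ?_
    filter_upwards [Ioo_mem_nhdsLT hlt] with s hs
    exact (feedbackProcess_eq hs.1.le hs.2).symm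

theorem exists_feedback : ∃ (π : Policy) (x : ℝ → ℝ), IsProcess a b x₀ π x ∧
    FollowsFeedback a x₀ (Ici xb) (thresholdImpulse b xb) π x := by
  have ha := h.ha
  set τ := feedbackTime a b xb x₀ with hτ
  set y := feedbackState b xb x₀ with hy
  let π : Policy :=
    { T := fun n => (τ n : EReal)
      v := fun n => thresholdImpulse b xb (max xb (y (n - 1)))
      T_zero := by simp [hτ, feedbackTime]
      T_one := EReal.coe_le_coe_iff.2 (feedbackTime_le_succ a b xb x₀ 0)
      T_lt := fun i hi _ => by
        obtain ⟨j, rfl⟩ := Nat.exists_eq_add_of_le' hi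
        exact EReal.coe_lt_coe_iff.2 (h.feedbackTime_lt_succ x₀ j)
      T_top := fun i hi => absurd hi (EReal.coe_ne_top _)
      T_tendsto := EReal.tendsto_coe_nhds_top_iff.2 (h.tendsto_feedbackTime x₀) }
  refine ⟨π, feedbackProcess a b xb x₀, ⟨fun t ht => if_pos ht, fun h1 => ?_, fun t ht hne => ?_,
    fun t ht => ?_, fun i t hi hT => ?_⟩, ⟨fun i => ?_, fun i t hi hT => ?_⟩⟩
  · have h2 : τ 0 < τ 1 := by
      refine lt_of_le_of_ne (feedbackTime_le_succ a b xb x₀ 0) fun h3 => h1 ?_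
      exact EReal.coe_eq_zero.2 h3.symm
    have := feedbackProcess_eq (n := 0) (t := 0) le_rfl h2
    simpa [feedbackState, feedbackTime] using this
  · obtain ⟨n, h1, h2⟩ := h.exists_feedback_interval x₀ ht.le
    have h3 : τ n < t := by
      refine lt_of_le_of_ne h1 fun heq => ?_
      rcases Nat.eq_zero_or_pos n with rfl | hn
      · exact ht.ne heq
      · exact hne n hn (EReal.coe_eq_coe_iff.2 heq)
    have hd : HasDerivAt (fun s => y n + a * (s - τ n)) a t := by
      simpa using (((hasDerivAt_id t).sub_const (τ n)).const_mul a).const_add (y n)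
    refine hd.congr_of_eventuallyEq ?_
    filter_upwards [Ioo_mem_nhds h3 h2] with s hs using feedbackProcess_eq hs.1.le hs.2
  · obtain ⟨n, h1, h2⟩ := h.exists_feedback_interval x₀ ht
    have hc : ContinuousWithinAt (fun s => y n + a * (s - τ n)) (Ici t) t :=
      Continuous.continuousWithinAt (by fun_prop)
    refine hc.congr_of_eventuallyEq ?_ (feedbackProcess_eq h1 h2)
    filter_upwards [Ico_mem_nhdsGE h2] with s hs
    exact feedbackProcess_eq (h1.trans hs.1) hs.2
  · obtain ⟨j, rfl⟩ := Nat.exists_eq_add_of_le' hi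
    have ht : t = τ (j + 1) := (EReal.coe_eq_coe_iff.1 hT).symm
    rw [ht, h.feedbackProcess_time, h.feedbackProcess_leftLim]
    rfl
  · have hpost : postState x₀ π (feedbackProcess a b xb x₀) i = y i := by
      unfold postState
      rcases i with _ | j
      · rfl
      · rw [if_neg (Nat.succ_ne_zero j)]
        exact h.feedbackProcess_time x₀ j
    rw [hpost]
    change ((τ (i + 1) : ℝ) : EReal) = sInf ((fun t : ℝ => (t : EReal)) ''
      {t : ℝ | (τ i : EReal) < (t : EReal) ∧ y i + a * (t - (τ i : EReal).toReal) ∈ Ici xb})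
    rw [EReal.toReal_coe, sInf_hitting ha]
    rfl
  · obtain ⟨j, rfl⟩ := Nat.exists_eq_add_of_le' hi
    have ht : t = τ (j + 1) := (EReal.coe_eq_coe_iff.1 hT).symm
    rw [ht, h.feedbackProcess_leftLim]
    rfl

theorem valueFunction_eq {x₀ : ℝ} (hx₀ : 0 < x₀) :
    valueFunction ρ a b α lam x₀ = (W ρ a b α lam xb x₀ : EReal) := by
  refine le_antisymm (sSup_le ?_) ?_
  · rintro _ ⟨π, x, hx, rfl⟩
    exact h.discountedReward_le hx₀ hx
  · obtain ⟨π, x, hx, hf⟩ := h.exists_feedback x₀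
    exact le_sSup ⟨π, x, hx, (h.discountedReward_eq_of_feedback hx₀ hx hf).symm⟩

end IsThreshold

end AIMD

theorem theorem4 (ρ a b α lam : ℝ) (hρ : 0 < ρ) (ha : 0 < a) (hb0 : 0 < b) (hb1 : b < 1)
    (hα1 : 1 < α) (hα2 : α < 2) (hlam : 0 < lam) :
    (∃! xb : ℝ, 0 < xb ∧ AIMD.H ρ a b α lam xb = 0) ∧
    ∀ xb : ℝ, 0 < xb → AIMD.H ρ a b α lam xb = 0 →
      ((∀ x, 0 < x → x < xb →
          AIMD.W ρ a b α lam xb x = AIMD.Wtilde ρ a α lam (AIMD.w1 ρ a b α lam xb) x) ∧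
        (∀ x, xb ≤ x → AIMD.W ρ a b α lam xb x = AIMD.W ρ a b α lam xb (b * x)) ∧
        AIMD.VerificationConditions ρ a b α lam (AIMD.W ρ a b α lam xb) ∅ (Ici xb)
          (AIMD.thresholdImpulse b xb)) ∧
      (∀ x₀ : ℝ, 0 < x₀ →
        AIMD.valueFunction ρ a b α lam x₀ = (AIMD.W ρ a b α lam xb x₀ : EReal) ∧
        (∃ (π : AIMD.Policy) (x : ℝ → ℝ), AIMD.IsProcess a b x₀ π x ∧
          AIMD.FollowsFeedback a x₀ (Ici xb) (AIMD.thresholdImpulse b xb) π x) ∧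
        (∀ (π : AIMD.Policy) (x : ℝ → ℝ), AIMD.IsProcess a b x₀ π x →
          AIMD.FollowsFeedback a x₀ (Ici xb) (AIMD.thresholdImpulse b xb) π x →
          AIMD.discountedReward ρ α lam x = (AIMD.W ρ a b α lam xb x₀ : EReal))) := by
  refine ⟨?_, fun xb hxb hH => ?_⟩
  · obtain ⟨z, hz, hHz, h1, h2⟩ := AIMD.exists_H_sign_change hρ ha hb0 hb1 hα1 hα2 hlam
    refine ⟨z, ⟨hz, hHz⟩, fun y hy => ?_⟩
    rcases lt_trichotomy y z with hlt | heq | hgt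
    · exact absurd hy.2 (h1 y hy.1 hlt).ne'
    · exact heq
    · exact absurd hy.2 (h2 y hgt).ne
  · have h : AIMD.IsThreshold ρ a b α lam xb :=
      ⟨hρ, ha, hb0, hb1, hα1, hα2, hlam, hxb, hH⟩
    exact ⟨⟨fun x _ hx => AIMD.W_of_lt hx, fun x hx => h.W_mul hx, h.verificationConditions⟩,
      fun x₀ hx₀ => ⟨h.valueFunction_eq hx₀, h.exists_feedback x₀,
        fun π x hx hf => h.discountedReward_eq_of_feedback hx₀ hx hf⟩⟩
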